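/- **Setting.** All graphs are finite, connected and 2-cell embedded in closed connected surfaces, and "Pauli operator" means Pauli operator modulo phases. A subsystem code is given by its gauge group, a subgroup of the Pauli group of a finite set of qubits. Two codes are regarded as the same if one gauge group is carried to the other by a bijection of the qubits together with a permutation of the labels $X,Y,Z$ on each single qubit. A *2-colex* is an embedded 3-valent graph with a proper 3-colouring of its faces; an edge is given the colour that does not occur on the two faces it separates. **2-colex of a graph.** For an embedded graph $\Gamma$, the 2-colex $\Gamma_2$ is obtained by splitting every edge into two edges bounding a new face and then expanding every vertex of degree $d$ into a face with $2d$ sides. Its faces are the $v$-, $e$- and $f$-faces, according to whether they come from vertices, edges or faces of $\Gamma$; these three classes are the colour classes. **Bombin's construction.** Given a 2-colex, take the dual graph, with its three vertex colours cyclically ordered, and direct each edge from a colour to the next one. Replace every directed edge by a 4-sided face and every vertex by a face with as many sides as its degree; the qubits are the resulting vertices. The gauge group is generated by the link operators $XX$ on the side of each 4-sided face at the tail of the directed edge, $YY$ on the side at its head, and $ZZ$ on its two other sides. **The new construction.** Given a 2-colex, choose a colour $r$ and a nonempty set $F$ of $r$-coloured faces, each with a number of sides that is divisible by $4$ and greater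 than $4$. For every $f\in F$ choose one of the two alternating sets of boundary edges of $f$ (the edges that $f$ shares with the faces of one of the other two colours). Inside $f$ add a cycle $f'$ with half as many vertices as $f$, one for each chosen edge in their cyclic order, and enlarge each chosen edge to a rank-3 edge by adding its vertex of $f'$. Edges of the 2-colex keep their colours, a rank-3 edge has the colour of its parent edge, and the edges of the cycles $f'$ are coloured so that a proper 3-edge-colouring of the hypergraph results; all rank-3 edges must have the same colour. Rename the colours as $X,Y,Z$ so that rank-3 edges have colour $Z$. The qubits are the vertices of the hypergraph, and the gauge group is generated by $P_uP_v$ for each rank-2 edge $\{u,v\}$ of colour $P\in\{X,Y,Z\}$ and by $Z_uZ_v, Z_vZ_w, Z_wZ_u$ for each rank-3 edge $\{u,v,w\}$. **Theorem.** 1. There is a code given by the new construction, from a hypergraph which has only edges of rank 2 and 3, is trivalent, has any two edges meeting in at most one vertex and any two rank-3 edges disjoint, that cannot be obtained from any 2-colex by Bombin's construction. 2. Let $\Gamma$ be a loopless embedded graph all of whose vertices have even degree greater than $2$, let $\Gamma_m$ be its medial graph, and let $\Gamma_2$ be the 2-colex of the dual $\Gamma_m^*$. Apply the new construction to $\Gamma_2$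 with $F$ the set of those $v$-faces that come from the vertices of $\Gamma$ (not those that come from faces of $\Gamma$) and with the rank-3 edges not in the boundaries of $e$-faces. No code so obtained can be obtained from any 2-colex by Bombin's construction. 3. Let $\Gamma$ be a loopless embedded graph all of whose vertices have even degree greater than $2$ and whose dual $\Gamma^*$ is not bipartite, and let $\Gamma_2$ be the 2-colex of $\Gamma$. Apply the new construction to $\Gamma_2$ with $F$ the set of all $v$-faces and with the rank-3 edges in the boundaries of the $e$-faces. No code so obtained can be obtained from any 2-colex by Bombin's construction. -/

import Mathlib

/-! ### Graphs embedded in surfaces -/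

/-- A finite connected graph with a 2-cell embedding in a closed connected surface (orientable or
not), presented by its flags.  A flag is an incident triple (vertex, edge, face), that is, a corner
of the barycentric subdivision of the embedding; `s 0`, `s 1`, `s 2` send a flag to the unique other
flag that differs from it only in the vertex, only in the edge, only in the face. -/
structure EmbeddedGraph where
  Flag : Type
  finite_flag : Finite Flag
  nonempty_flag : Nonempty Flag
  s : Fin 3 → Flag → Flag
  invol : ∀ i φ, s i (s i φ) = φ
  ne_self : ∀ i φ, s i φ ≠ φ
  comm : ∀ φ, s 0 (s 2 φ) = s 2 (s 0 φ)
  ne_diag : ∀ φ, s 0 (s 2 φ) ≠ φ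
  connected : Subsingleton (Quot fun φ ψ : Flag => ∃ i : Fin 3, ψ = s i φ)

namespace EmbeddedGraph

variable (M : EmbeddedGraph)

/-- Orbits of flags under the involutions `s i` with `i ∈ T`. -/
def Cell (T : Set (Fin 3)) : Type := Quot fun φ ψ : M.Flag => ∃ i ∈ T, ψ = M.s i φ

/-- The vertices of the graph. -/
abbrev Vertex : Type := M.Cell {1, 2}
/-- The edges of the graph. -/
abbrev Edge : Type := M.Cell {0, 2}
/-- The faces of the embedding. -/
abbrev Face : Type := M.Cell {0, 1}
/-- The corners of the embedding: a vertex together with a sector of a face at this vertex. -/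
abbrev Corner : Type := M.Cell {1}

def vertex (φ : M.Flag) : M.Vertex := Quot.mk _ φ
def edge (φ : M.Flag) : M.Edge := Quot.mk _ φ
def face (φ : M.Flag) : M.Face := Quot.mk _ φ
def corner (φ : M.Flag) : M.Corner := Quot.mk _ φ

/-- The degree of a vertex: every edge end at the vertex carries two flags (its two sides). -/
noncomputable def degree (v : M.Vertex) : ℕ := Nat.card {φ : M.Flag // M.vertex φ = v} / 2

/-- The number of sides of a face: every side carries two flags (its two ends). -/
noncomputable def faceSize (f : M.Face) : ℕ := Nat.card {φ : M.Flag // M.face φ = f} / 2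

/-- No edge joins a vertex to itself. -/
def Loopless : Prop := ∀ φ : M.Flag, M.vertex φ ≠ M.vertex (M.s 0 φ)

/-- The graph has a proper 2-colouring of its vertices. -/
def IsBipartite : Prop :=
  ∃ κ : M.Vertex → Bool, ∀ φ : M.Flag, κ (M.vertex φ) ≠ κ (M.vertex (M.s 0 φ))

/-- The dual embedded graph: vertices and faces are exchanged. -/
def dual : EmbeddedGraph where
  Flag := M.Flag
  finite_flag := M.finite_flag
  nonempty_flag := M.nonempty_flag
  s i := M.s (Fin.rev i)
  invol i φ := M.invol _ φ
  ne_self i φ := M.ne_self _ φ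
  comm φ := (M.comm φ).symm
  ne_diag φ := by
    have h := M.ne_diag φ
    rw [M.comm φ] at h
    exact h
  connected := by
    refine ⟨fun a b => ?_⟩
    have key : ∀ φ ψ : M.Flag, (Quot.mk (fun φ ψ : M.Flag => ∃ i : Fin 3, ψ = M.s i φ) φ)
        = Quot.mk _ ψ := fun φ ψ => M.connected.elim _ _
    induction a using Quot.ind with | _ φ
    induction b using Quot.ind with | _ ψ
    have h := congrArg (Quot.lift (fun χ : M.Flag =>
      (Quot.mk (fun φ ψ : M.Flag => ∃ i : Fin 3, ψ = M.s (Fin.rev i) φ) χ)) (by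
        rintro x y ⟨i, rfl⟩
        exact Quot.sound ⟨Fin.rev i, by rw [Fin.rev_rev]⟩)) (key φ ψ)
    exact h

/-- The medial graph: a vertex on every edge, and an edge for every corner, joining the two edges
which are consecutive at this corner.  A flag of the medial graph is a flag `(v, e, f)` of the graph
together with one of the two faces of the medial graph at the corner `(v, f)`: the one around `v`
(`true`) or the one inside `f` (`false`). -/
def medial : EmbeddedGraph where
  Flag := M.Flag × Bool
  finite_flag := by have := M.finite_flag; infer_instance
  nonempty_flag := by have := M.nonempty_flag; infer_instance
  s := ![fun p => (M.s 1 p.1, p.2),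
    fun p => (if p.2 then M.s 2 p.1 else M.s 0 p.1, p.2),
    fun p => (p.1, !p.2)]
  invol i p := by
    obtain ⟨φ, b⟩ := p
    fin_cases i <;> cases b <;> simp [M.invol]
  ne_self i p := by
    obtain ⟨φ, b⟩ := p
    fin_cases i <;> cases b <;> simp [M.ne_self]
  comm p := by simp
  ne_diag p := by
    obtain ⟨φ, b⟩ := p
    cases b <;> simp
  connected := by
    refine ⟨fun a b => ?_⟩
    induction a using Quot.ind with | _ p
    induction b using Quot.ind with | _ q
    obtain ⟨φ, b⟩ := p
    obtain ⟨ψ, c⟩ := q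
    set R : M.Flag × Bool → M.Flag × Bool → Prop := fun x y => ∃ i : Fin 3, y =
      (![fun p => (M.s 1 p.1, p.2), fun p => (if p.2 then M.s 2 p.1 else M.s 0 p.1, p.2),
        fun p => (p.1, !p.2)] : Fin 3 → M.Flag × Bool → M.Flag × Bool) i x with hR
    have h2 : ∀ (χ : M.Flag) (d : Bool), Quot.mk R (χ, d) = Quot.mk R (χ, true) := by
      intro χ d
      cases d
      · exact Quot.sound ⟨2, by simp⟩
      · rfl
    have key := M.connected.elim (Quot.mk _ φ) (Quot.mk _ ψ)
    have h := congrArg (Quot.lift (fun χ : M.Flag => Quot.mk R (χ, true)) (by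
        rintro x y ⟨i, rfl⟩
        fin_cases i
        · refine (h2 x false).symm.trans (Eq.trans ?_ (h2 (M.s 0 x) false))
          exact Quot.sound ⟨1, by simp⟩
        · exact Quot.sound ⟨0, by simp⟩
        · exact Quot.sound ⟨1, by simp⟩)) key
    exact (h2 φ b).trans (Eq.trans h (h2 ψ c).symm)

end EmbeddedGraph

/-! ### 2-colexes -/

/-- A 2-colex: an embedded 3-valent graph with a proper 3-colouring of its faces. -/
structure TwoColex extends EmbeddedGraph where
  cubic : ∀ v, toEmbeddedGraph.degree v = 3
  color : toEmbeddedGraph.Face → Fin 3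
  color_ne : ∀ φ, color (toEmbeddedGraph.face φ) ≠ color (toEmbeddedGraph.face (s 2 φ))

namespace TwoColex

variable (M : TwoColex)

/-- The colour of an edge is the colour which does not occur on the two faces that it separates
(the three colours add up to `0` modulo 3). -/
def edgeColor (φ : M.Flag) : Fin 3 := -(M.color (M.face φ) + M.color (M.face (M.s 2 φ)))

end TwoColex

namespace EmbeddedGraph

variable (M : EmbeddedGraph)

/-- The 2-colex of an embedded graph: every edge is split into two edges which bound a new face, and
then every vertex of degree `d` is expanded into a face with `2 d` sides.  Its vertices are the flags
of the graph; two of them are joined by an edge of colour `i` if they are exchanged by `s i`; its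
faces of colour `0`, `1`, `2` are the `v`-faces, the `e`-faces and the `f`-faces.  In a flag
`(φ, π)`, the vertex is `φ`, the colour of the edge is `π 0` and the colour of the face is `π 2`. -/
def flagMap : EmbeddedGraph where
  Flag := M.Flag × Equiv.Perm (Fin 3)
  finite_flag := by have := M.finite_flag; infer_instance
  nonempty_flag := by have := M.nonempty_flag; infer_instance
  s := ![fun p => (M.s (p.2 0) p.1, p.2),
    fun p => (p.1, p.2 * Equiv.swap 0 1),
    fun p => (p.1, p.2 * Equiv.swap 1 2)]
  invol i p := by
    fin_cases i <;> simp [M.invol, mul_assoc]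
  ne_self i p := by
    obtain ⟨φ, π⟩ := p
    fin_cases i
    · simp [M.ne_self]
    · simp
    · simp
  comm p := by
    obtain ⟨φ, π⟩ := p
    have h : (Equiv.swap 1 2 : Equiv.Perm (Fin 3)) 0 = 0 := by decide
    simp [h]
  ne_diag p := by
    obtain ⟨φ, π⟩ := p
    simp
  connected := by
    refine ⟨fun a b => ?_⟩
    induction a using Quot.ind with | _ p
    induction b using Quot.ind with | _ q
    obtain ⟨φ, π⟩ := p
    obtain ⟨ψ, τ⟩ := q
    set R : M.Flag × Equiv.Perm (Fin 3) → M.Flag × Equiv.Perm (Fin 3) → Prop :=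
      fun x y => ∃ i : Fin 3, y =
      (![fun p => (M.s (p.2 0) p.1, p.2), fun p => (p.1, p.2 * Equiv.swap 0 1),
        fun p => (p.1, p.2 * Equiv.swap 1 2)] : Fin 3 → M.Flag × Equiv.Perm (Fin 3) →
          M.Flag × Equiv.Perm (Fin 3)) i x with hR
    have ha : ∀ (χ : M.Flag) (π : Equiv.Perm (Fin 3)),
        Quot.mk R (χ, π) = Quot.mk R (χ, π * Equiv.swap 0 1) :=
      fun χ π => Quot.sound ⟨1, by simp⟩
    have hb : ∀ (χ : M.Flag) (π : Equiv.Perm (Fin 3)),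
        Quot.mk R (χ, π) = Quot.mk R (χ, π * Equiv.swap 1 2) :=
      fun χ π => Quot.sound ⟨2, by simp⟩
    have hgen : ∀ g : Equiv.Perm (Fin 3), g = 1 ∨ g = Equiv.swap 0 1 ∨ g = Equiv.swap 1 2 ∨
        g = Equiv.swap 0 1 * Equiv.swap 1 2 ∨ g = Equiv.swap 1 2 * Equiv.swap 0 1 ∨
        g = Equiv.swap 0 1 * Equiv.swap 1 2 * Equiv.swap 0 1 := by decide
    have h1 : ∀ (χ : M.Flag) (g : Equiv.Perm (Fin 3)), Quot.mk R (χ, 1) = Quot.mk R (χ, g) := by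
      intro χ g
      rcases hgen g with h | h | h | h | h | h <;> subst h
      · rfl
      · simpa using ha χ 1
      · simpa using hb χ 1
      · simpa using (ha χ 1).trans (hb χ _)
      · simpa using (hb χ 1).trans (ha χ _)
      · simpa using ((ha χ 1).trans (hb χ _)).trans (ha χ _)
    have key := M.connected.elim (Quot.mk _ φ) (Quot.mk _ ψ)
    have h := congrArg (Quot.lift (fun χ : M.Flag => Quot.mk R (χ, 1)) (by
        rintro x y ⟨i, rfl⟩
        refine (h1 x (Equiv.swap 0 i)).trans (Eq.trans ?_ (h1 (M.s i x) (Equiv.swap 0 i)).symm)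
        exact Quot.sound ⟨0, by simp⟩)) key
    exact (h1 φ π).symm.trans (Eq.trans h (h1 ψ τ))

theorem flagMap_vertex_eq (φ ψ : M.Flag) (π τ : Equiv.Perm (Fin 3)) :
    M.flagMap.vertex (φ, π) = M.flagMap.vertex (ψ, τ) ↔ φ = ψ := by
  constructor
  · intro h
    exact congrArg (Quot.lift (fun x : M.flagMap.Flag => x.1) (by
      rintro x y ⟨i, hi, rfl⟩
      rcases hi with rfl | rfl <;> rfl)) h
  · rintro rfl
    have ha : ∀ π : Equiv.Perm (Fin 3),
        M.flagMap.vertex (φ, π) = M.flagMap.vertex (φ, π * Equiv.swap 0 1) :=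
      fun π => Quot.sound ⟨1, by simp, rfl⟩
    have hb : ∀ π : Equiv.Perm (Fin 3),
        M.flagMap.vertex (φ, π) = M.flagMap.vertex (φ, π * Equiv.swap 1 2) :=
      fun π => Quot.sound ⟨2, by simp, rfl⟩
    have hgen : ∀ g : Equiv.Perm (Fin 3), g = 1 ∨ g = Equiv.swap 0 1 ∨ g = Equiv.swap 1 2 ∨
        g = Equiv.swap 0 1 * Equiv.swap 1 2 ∨ g = Equiv.swap 1 2 * Equiv.swap 0 1 ∨
        g = Equiv.swap 0 1 * Equiv.swap 1 2 * Equiv.swap 0 1 := by decide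
    have h1 : ∀ g : Equiv.Perm (Fin 3), M.flagMap.vertex (φ, 1) = M.flagMap.vertex (φ, g) := by
      intro g
      rcases hgen g with h | h | h | h | h | h <;> subst h
      · rfl
      · simpa using ha 1
      · simpa using hb 1
      · simpa using (ha 1).trans (hb _)
      · simpa using (hb 1).trans (ha _)
      · simpa using ((ha 1).trans (hb _)).trans (ha _)
    exact (h1 π).symm.trans (h1 τ)

/-- The 2-colex `flagMap` with its face colouring (`0`: `v`-faces, `1`: `e`-faces,
`2`: `f`-faces). -/
def colex : TwoColex where
  toEmbeddedGraph := M.flagMap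
  cubic v := by
    induction v using Quot.ind with | _ p
    obtain ⟨φ, π⟩ := p
    have e : {x : M.flagMap.Flag // M.flagMap.vertex x = M.flagMap.vertex (φ, π)} ≃
        Equiv.Perm (Fin 3) :=
      { toFun := fun x => x.1.2
        invFun := fun τ => ⟨(φ, τ), (M.flagMap_vertex_eq φ φ τ π).2 rfl⟩
        left_inv := by
          rintro ⟨⟨ψ, τ⟩, h⟩
          obtain rfl := (M.flagMap_vertex_eq ψ φ τ π).1 h
          rfl
        right_inv := fun τ => rfl }
    have h : Nat.card {x : M.flagMap.Flag // M.flagMap.vertex x = M.flagMap.vertex (φ, π)} = 6 := by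
      rw [Nat.card_congr e, Nat.card_eq_fintype_card]
      decide
    change Nat.card {x : M.flagMap.Flag // M.flagMap.vertex x = M.flagMap.vertex (φ, π)} / 2 = 3
    rw [h]
  color := Quot.lift (fun x : M.flagMap.Flag => x.2 2) (by
    rintro ⟨φ, π⟩ y ⟨i, hi, rfl⟩
    rcases hi with rfl | rfl
    · rfl
    · have h : (Equiv.swap 0 1 : Equiv.Perm (Fin 3)) 2 = 2 := by decide
      change π 2 = (π * Equiv.swap 0 1 : Equiv.Perm (Fin 3)) 2
      rw [Equiv.Perm.mul_apply, h])
  color_ne := by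
    rintro ⟨φ, π⟩ h
    have h' : π 2 = (π * Equiv.swap 1 2 : Equiv.Perm (Fin 3)) 2 := h
    rw [Equiv.Perm.mul_apply, Equiv.swap_apply_right] at h'
    exact absurd (π.injective h') (by decide)

end EmbeddedGraph

/-! ### Subsystem codes -/

/-- The one-qubit Pauli operators modulo phases, with `(x, z)` standing for `X ^ x * Z ^ z`. -/
abbrev Pauli : Type := ZMod 2 × ZMod 2

def pauliX : Pauli := (1, 0)
def pauliY : Pauli := (1, 1)
def pauliZ : Pauli := (0, 1)

/-- The Pauli operators `X`, `Y`, `Z` attached to the colours `0`, `1`, `2`. -/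
def pauliOfColor : Fin 3 → Pauli := ![pauliX, pauliY, pauliZ]

/-- A subsystem code: a set of qubits and the gauge group, a subgroup of the Pauli group
(modulo phases) of these qubits. -/
structure SubsystemCode where
  Qubit : Type
  finite_qubit : Finite Qubit
  gauge : AddSubgroup (Qubit → Pauli)

/-- Two subsystem codes are the same up to renaming the qubits and renaming the operators `X`, `Y`,
`Z` on every single qubit (the action of local Clifford operators). -/
def SubsystemCode.Equivalent (C D : SubsystemCode) : Prop :=
  ∃ (σ : C.Qubit ≃ D.Qubit) (L : C.Qubit → (Pauli ≃+ Pauli)), ∀ g : C.Qubit → Pauli,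
    g ∈ C.gauge ↔ (fun q => L (σ.symm q) (g (σ.symm q))) ∈ D.gauge

open Classical in
/-- The two-body operator acting as `P` on the qubits `u` and `v`. -/
noncomputable def linkOp {Q : Type} (u v : Q) (P : Pauli) : Q → Pauli :=
  fun q => if q = u ∨ q = v then P else 0

/-! ### Bombin's construction -/

namespace TwoColex

variable (M : TwoColex)

/-- Bombin's subsystem code of a 2-colex.  In the dual graph, whose vertices are coloured, an edge is
directed from the colour `c` to the colour `c + 1`.  Every directed edge becomes a 4-sided face and
every vertex a face with as many sides as its degree, so that the qubits are the corners of the dual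
graph.  The side of the 4-sided face at the tail of the edge carries `XX`, the side at the head `YY`,
and the two other sides `ZZ`. -/
def bombinCode : SubsystemCode where
  Qubit := M.dual.Corner
  finite_qubit := by
    have : Finite M.dual.Flag := M.dual.finite_flag
    exact Finite.of_surjective M.dual.corner Quot.mk_surjective
  gauge := AddSubgroup.closure
    ({g | ∃ φ : M.dual.Flag, M.color (M.face (M.dual.s 0 φ)) = M.color (M.face φ) + 1 ∧
        g = linkOp (M.dual.corner φ) (M.dual.corner (M.dual.s 2 φ)) pauliX} ∪
      {g | ∃ φ : M.dual.Flag, M.color (M.face φ) = M.color (M.face (M.dual.s 0 φ)) + 1 ∧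
        g = linkOp (M.dual.corner φ) (M.dual.corner (M.dual.s 2 φ)) pauliY} ∪
      {g | ∃ φ : M.dual.Flag,
        g = linkOp (M.dual.corner φ) (M.dual.corner (M.dual.s 0 φ)) pauliZ})

end TwoColex

/-- The codes that can be obtained from Bombin's construction. -/
def IsBombinCode (C : SubsystemCode) : Prop := ∃ M : TwoColex, C.Equivalent M.bombinCode

/-! ### Subsystem codes from hypergraphs -/

namespace Hypergraph

variable {V : Type} (H : Hypergraph V)

/-- The requirements on a hypergraph: all edges have rank 2 or 3, every vertex is trivalent, two
edges meet in at most one vertex, and edges of rank 3 are pairwise disjoint. -/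
structure IsAdmissible : Prop where
  rank : ∀ e ∈ H.edgeSet, e.ncard = 2 ∨ e.ncard = 3
  trivalent : ∀ v ∈ H.vertexSet, {e ∈ H.edgeSet | v ∈ e}.ncard = 3
  inter : ∀ e ∈ H.edgeSet, ∀ e' ∈ H.edgeSet, e ≠ e' → (e ∩ e').Subsingleton
  disjoint : ∀ e ∈ H.edgeSet, ∀ e' ∈ H.edgeSet, e ≠ e' → e.ncard = 3 → e'.ncard = 3 →
    Disjoint e e'

/-- A proper 3-edge-colouring in which all edges of rank 3 get the colour `2`. -/
structure IsEdgeColoring (col : Set V → Fin 3) : Prop where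
  proper : ∀ e ∈ H.edgeSet, ∀ e' ∈ H.edgeSet, e ≠ e' → (e ∩ e').Nonempty → col e ≠ col e'
  rank_three : ∀ e ∈ H.edgeSet, e.ncard = 3 → col e = 2

/-- The subsystem code of an edge-coloured hypergraph: a qubit at every vertex, the link operator
`XX`, `YY` or `ZZ`, according to its colour, for every edge of rank 2, and the three link operators
`ZZ` for every edge of rank 3. -/
def code [Finite V] (col : Set V → Fin 3) : SubsystemCode where
  Qubit := H.vertexSet
  finite_qubit := inferInstance
  gauge := AddSubgroup.closure
    ({g | ∃ u v : H.vertexSet, u ≠ v ∧ {u.1, v.1} ∈ H.edgeSet ∧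
        g = linkOp u v (pauliOfColor (col {u.1, v.1}))} ∪
      {g | ∃ e ∈ H.edgeSet, e.ncard = 3 ∧ ∃ u v : H.vertexSet, u.1 ∈ e ∧ v.1 ∈ e ∧ u ≠ v ∧
        g = linkOp u v pauliZ})

end Hypergraph

/-! ### The new construction: hypergraphs from 2-colexes -/

/-- The choices made in the construction: a colour `r`, a nonempty set `F` of `r`-coloured faces whose
numbers of sides are greater than 4 and divisible by 4, and, for every `f ∈ F`, one of the two sets of
alternating edges of `f`: those on the boundary of faces of the colour `side f`. -/
structure Promotion (M : TwoColex) where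
  r : Fin 3
  F : Set M.Face
  nonempty : F.Nonempty
  color_eq : ∀ f ∈ F, M.color f = r
  size : ∀ f ∈ F, 4 ∣ M.faceSize f ∧ 4 < M.faceSize f
  side : M.Face → Fin 3
  side_ne : ∀ f ∈ F, side f ≠ r

namespace Promotion

variable {M : TwoColex} (D : Promotion M)

/-- The edge of the flag is one of the chosen edges of its face, and this face is in `F`. -/
def IsPromoted (φ : M.Flag) : Prop :=
  M.face φ ∈ D.F ∧ M.color (M.face (M.s 2 φ)) = D.side (M.face φ)

/-- The edges which are promoted to edges of rank 3. -/
def PromotedEdge : Type := {e : M.Edge // ∃ φ, M.edge φ = e ∧ D.IsPromoted φ}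

def promotedEdge (φ : M.Flag) (h : D.IsPromoted φ) : D.PromotedEdge := ⟨M.edge φ, φ, rfl, h⟩

/-- The vertices of the hypergraph: those of the 2-colex and a new one for every promoted edge. -/
abbrev HVertex : Type := M.Vertex ⊕ D.PromotedEdge

instance : Finite D.HVertex := by
  have : Finite M.Flag := M.finite_flag
  have : Finite M.Vertex := Finite.of_surjective M.vertex Quot.mk_surjective
  have : Finite M.Edge := Finite.of_surjective M.edge Quot.mk_surjective
  have : Finite D.PromotedEdge := Subtype.finite
  infer_instance

/-- An edge of the 2-colex, as a set of vertices of the hypergraph. -/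
def oldEdge (φ : M.Flag) : Set D.HVertex :=
  {Sum.inl (M.vertex φ), Sum.inl (M.vertex (M.s 0 φ))}

/-- The edge of rank 3 into which a promoted edge is turned. -/
def rankThreeEdge (φ : M.Flag) (h : D.IsPromoted φ) : Set D.HVertex :=
  {Sum.inl (M.vertex φ), Sum.inl (M.vertex (M.s 0 φ)), Sum.inr (D.promotedEdge φ h)}

/-- The hypergraph.  Inside a face `f ∈ F`, the new vertices form a face `f'` in which the new
vertices of two consecutive promoted edges of `f` are adjacent: walking along the boundary of `f` from
a promoted edge, over the next edge, one arrives at the next promoted edge. -/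
def hypergraph : Hypergraph D.HVertex where
  vertexSet := Set.univ
  edgeSet :=
    {e | ∃ φ : M.Flag, (¬ ∃ ψ, M.edge ψ = M.edge φ ∧ D.IsPromoted ψ) ∧ e = D.oldEdge φ} ∪
    {e | ∃ (φ : M.Flag) (h : D.IsPromoted φ), e = D.rankThreeEdge φ h} ∪
    {e | ∃ (φ : M.Flag) (h : D.IsPromoted φ) (h' : D.IsPromoted (M.s 1 (M.s 0 (M.s 1 φ)))),
      e = {Sum.inr (D.promotedEdge φ h), Sum.inr (D.promotedEdge _ h')}}
  subset_vertexSet_of_mem_edgeSet' := fun _ _ => Set.subset_univ _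

/-- The edge colourings used by the construction: up to the names of the colours, the edges of the
2-colex keep their colours and an edge of rank 3 has the colour of its parent edge. -/
structure IsColoring (col : Set D.HVertex → Fin 3) : Prop where
  isEdgeColoring : D.hypergraph.IsEdgeColoring col
  inherited : ∃ π : Equiv.Perm (Fin 3),
    (∀ φ : M.Flag, (¬ ∃ ψ, M.edge ψ = M.edge φ ∧ D.IsPromoted ψ) →
      col (D.oldEdge φ) = π (M.edgeColor φ)) ∧
    (∀ (φ : M.Flag) (h : D.IsPromoted φ), col (D.rankThreeEdge φ h) = π (M.edgeColor φ))

end Promotion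

/-! ### Two families of choices -/

namespace EmbeddedGraph

variable (Γ : EmbeddedGraph)

/-- In the 2-colex of `Γ`: `F` consists of all `v`-faces and the edges of rank 3 are in the boundaries
of the `e`-faces. -/
def IsVertexPromotion (D : Promotion Γ.colex) : Prop :=
  D.F = {f | Γ.colex.color f = 0} ∧ ∀ f ∈ D.F, D.side f = 1

/-- In the 2-colex of the dual of the medial graph of `Γ`: `F` consists of the `v`-faces whose parents
come from the vertices of `Γ` and the edges of rank 3 are not in the boundaries of the `e`-faces. -/
def IsMedialPromotion (D : Promotion Γ.medial.dual.colex) : Prop :=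
  D.F = {f | ∃ (φ : Γ.Flag) (π : Equiv.Perm (Fin 3)),
      π 2 = 0 ∧ f = Γ.medial.dual.colex.face ((φ, true), π)} ∧
    ∀ f ∈ D.F, D.side f ≠ 1

end EmbeddedGraph

/-! ### Counting the gauge group of a code with two perfect matchings -/

/-! The obstruction is numerical: the number of qubits and the order of the gauge group are
invariants of a code up to equivalence, and Bombin's codes satisfy a rigid relation between them.

In both constructions the qubits form a set `Q` with two fixed-point-free involutions `a` and `b`,
the `XX` and `YY` links, and a surjection `t : Q → T` whose fibres carry the `ZZ` links. The gauge
group is the image of the invariant functions of `a`, those of `b` and the fibrewise even functions,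
and the kernel is the group `K` of functions with all three properties. Rank and nullity give `|G| *
|K| * 2 ^ |T| = 2 ^ (2 * |Q|)` (`card_matchingGauge`).

For a 2-colex with `t` vertices, Bombin's code has `3 * t` qubits and `|T| = t`. An element of `K`
is a function on the faces whose sum at every vertex is zero; by connectedness it is determined by
two adjacent faces, and all choices come from the face colouring, so `|K| = 4` (`card_relations`).

For the new construction in the 2-colex of `N`, the fibres of `t` are the edges of colour `2`, half
as many as the flags of `N`, and the qubits are the flags plus half of the flags at which edges are
promoted.

For the vertex promotion this gives three qubits per fibre, as for Bombin, so `|K|` would have to be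
`4`. But an element of `K` restricts to a function `u` on the faces of `Γ`, and the sum of `u`
across an edge is the same for all edges. If that sum is `1`, then `u` is a proper 2-colouring of
`Γ.dual`; otherwise `u` is constant. Hence `|K| ≤ 2` when the dual is not bipartite.

For the medial promotion, with `m` flags of `Γ`, there are `5 * m / 2` qubits and `m` fibres.
Comparison with Bombin's relation forces `m ≤ 12` whatever `K` is, while the degree hypothesis and
the absence of loops give `m ≥ 16`.

The existence claim follows by applying the vertex promotion to two vertices joined by four edges in
the projective plane. -/

/-- The functions that are invariant under `a`. -/
def invariantFunctions {Q : Type} (a : Q → Q) : AddSubgroup (Q → ZMod 2) where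
  carrier := {s | ∀ q, s (a q) = s q}
  add_mem' hs ht q := by simp [hs q, ht q]
  zero_mem' _ := rfl
  neg_mem' hs q := by simp [hs q]

open Classical in
/-- The functions whose sum over every fibre of `t` vanishes. -/
def evenFunctions {Q T : Type} [Fintype Q] (t : Q → T) : AddSubgroup (Q → ZMod 2) where
  carrier := {s | ∀ τ, ∑ q with t q = τ, s q = 0}
  add_mem' hs ht τ := by simp [Finset.sum_add_distrib, hs τ, ht τ]
  zero_mem' _ := by simp
  neg_mem' hs τ := by simp [hs τ]

theorem mem_invariantFunctions {Q : Type} {a : Q → Q} {s : Q → ZMod 2} :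
    s ∈ invariantFunctions a ↔ ∀ q, s (a q) = s q := Iff.rfl

open Classical in
theorem mem_evenFunctions {Q T : Type} [Fintype Q] {t : Q → T} {s : Q → ZMod 2} :
    s ∈ evenFunctions t ↔ ∀ τ, ∑ q with t q = τ, s q = 0 := Iff.rfl

theorem AddMonoidHom.card_ker_mul_card_range {G H : Type*} [AddGroup G] [AddGroup H]
    (f : G →+ H) : Nat.card f.ker * Nat.card f.range = Nat.card G := by
  rw [← AddSubgroup.index_ker, AddSubgroup.card_mul_index]

theorem exists_transversal {Q : Type} [Finite Q] {a : Q → Q} (ha : ∀ q, a (a q) = q)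
    (hne : ∀ q, a q ≠ q) : ∃ R : Q → Prop, ∀ q, R (a q) ↔ ¬ R q := by
  obtain ⟨n, ⟨e⟩⟩ := Finite.exists_equiv_fin Q
  -- A numbering of `Q` selects the smaller point of each pair `{q, a q}`.
  refine ⟨fun q => e q < e (a q), fun q => ?_⟩
  have : e q ≠ e (a q) := fun h => hne q (e.injective h).symm
  change e (a q) < e (a (a q)) ↔ ¬ e q < e (a q)
  rw [ha]
  omega

-- The endomorphism `s ↦ s + s ∘ a` has the invariant functions both as kernel, by characteristic
-- two, and as range: an invariant function is the image of its restriction to a transversal. The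
-- squared form avoids halving the exponent.
open Classical in
theorem card_invariantFunctions_sq {Q : Type} [Finite Q] {a : Q → Q} (ha : ∀ q, a (a q) = q)
    (hne : ∀ q, a q ≠ q) :
    Nat.card (invariantFunctions a) * Nat.card (invariantFunctions a) = 2 ^ Nat.card Q := by
  obtain ⟨R, hR⟩ := exists_transversal ha hne
  let f : (Q → ZMod 2) →+ (Q → ZMod 2) :=
    { toFun := fun s q => s q + s (a q)
      map_zero' := by ext; simp
      map_add' := fun s t => by ext; simp; ring }
  have hker : f.ker = invariantFunctions a := by
    ext s
    rw [AddMonoidHom.mem_ker, mem_invariantFunctions, funext_iff]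
    refine forall_congr' fun q => ?_
    change s q + s (a q) = 0 ↔ _
    rw [CharTwo.add_eq_zero, eq_comm]
  have hrange : f.range = invariantFunctions a := by
    ext s
    constructor
    · rintro ⟨u, rfl⟩ q
      change u (a q) + u (a (a q)) = u q + u (a q)
      rw [ha, add_comm]
    · intro hs
      refine ⟨fun q => if R q then s q else 0, ?_⟩
      ext q
      change (if R q then s q else 0) + (if R (a q) then s (a q) else 0) = s q
      by_cases h : R q <;> simp [hR, h, hs q]
  have h := f.card_ker_mul_card_range
  rw [hker, hrange] at h
  rw [h, Nat.card_fun, Nat.card_zmod]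

-- The even functions are the kernel of the map taking sums over the fibres, which is onto because
-- one point of each fibre can carry any prescribed value.
open Classical in
theorem card_evenFunctions {Q T : Type} [Fintype Q] [Finite T] {t : Q → T}
    (ht : Function.Surjective t) :
    Nat.card (evenFunctions t) * 2 ^ Nat.card T = 2 ^ Nat.card Q := by
  let f : (Q → ZMod 2) →+ (T → ZMod 2) :=
    { toFun := fun s τ => ∑ q with t q = τ, s q
      map_zero' := by ext; simp
      map_add' := fun s t => by ext; simp [Finset.sum_add_distrib] }
  have hker : f.ker = evenFunctions t := by
    ext s
    rw [AddMonoidHom.mem_ker, mem_evenFunctions, funext_iff]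
    rfl
  have hrange : f.range = ⊤ := by
    rw [AddMonoidHom.range_eq_top]
    intro s
    choose ρ hρ using ht
    refine ⟨fun q => if q = ρ (t q) then s (t q) else 0, ?_⟩
    ext τ
    change ∑ q with t q = τ, (if q = ρ (t q) then s (t q) else 0) = s τ
    rw [Finset.sum_eq_single (ρ τ)]
    · simp [hρ]
    · intro q hq hne
      rw [Finset.mem_filter] at hq
      rw [hq.2, if_neg hne]
    · intro h
      simp [hρ] at h
  have h := f.card_ker_mul_card_range
  rw [hker, hrange, AddSubgroup.card_top, Nat.card_fun, Nat.card_fun, Nat.card_zmod] at h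
  exact h

/-- The gauge group generated by `XX` on the pairs `{q, a q}`, by `YY` on the pairs `{q, b q}` and by
`ZZ` on the pairs in a fibre of `t`. -/
noncomputable def matchingGauge {Q T : Type} (a b : Q → Q) (t : Q → T) :
    AddSubgroup (Q → Pauli) :=
  AddSubgroup.closure
    ({g | ∃ q, g = linkOp q (a q) pauliX} ∪ {g | ∃ q, g = linkOp q (b q) pauliY} ∪
      {g | ∃ q q', q ≠ q' ∧ t q = t q' ∧ g = linkOp q q' pauliZ})

open Classical in
theorem linkOp_eq_single {Q : Type} {u v : Q} (h : u ≠ v) (P : Pauli) :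
    linkOp u v P = Pi.single u P + Pi.single v P := by
  ext1 q
  rcases eq_or_ne q u with rfl | hu
  · simp [linkOp, h]
  · rcases eq_or_ne q v with rfl | hv
    · simp [linkOp, h]
    · simp [linkOp, hu, hv]

theorem smul_mem_of_zmod_two {M : Type*} [AddCommGroup M] [Module (ZMod 2) M] {G : AddSubgroup M}
    {x : M} (hx : x ∈ G) (c : ZMod 2) : c • x ∈ G := by
  fin_cases c
  · change (0 : ZMod 2) • x ∈ G
    rw [zero_smul]
    exact G.zero_mem
  · change (1 : ZMod 2) • x ∈ G
    rwa [one_smul]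

-- An invariant function is a combination of the indicators of the pairs `{q, a q}`, one for each
-- point of a transversal.
open Classical in
theorem invariant_smul_mem {Q : Type} [Fintype Q] {a : Q → Q} (ha : ∀ q, a (a q) = q)
    (hne : ∀ q, a q ≠ q) {G : AddSubgroup (Q → Pauli)} {P : Pauli}
    (hG : ∀ q, linkOp q (a q) P ∈ G) {α : Q → ZMod 2} (hα : α ∈ invariantFunctions a) :
    (fun q => α q • P) ∈ G := by
  obtain ⟨R, hR⟩ := exists_transversal ha hne
  have key : (fun q => α q • P) = ∑ q with R q, α q • linkOp q (a q) P := by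
    have h1 : (fun q => α q • P) = ∑ q, Pi.single q (α q • P) :=
      (Finset.univ_sum_single (fun q => α q • P)).symm
    have h2 : ∑ q with ¬ R q, (Pi.single q (α q • P) : Q → Pauli)
        = ∑ q with R q, Pi.single (a q) (α q • P) := by
      refine Finset.sum_bij' (fun q _ => a q) (fun q _ => a q) ?_ ?_ ?_ ?_ ?_
      · intro q hq
        simpa [hR] using hq
      · intro q hq
        simpa [hR] using hq
      · intro q _; exact ha q
      · intro q _; exact ha q
      · intro q _
        rw [ha, hα q]
    rw [h1, ← Finset.sum_filter_add_sum_filter_not _ R, h2, ← Finset.sum_add_distrib]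
    refine Finset.sum_congr rfl fun q _ => ?_
    rw [linkOp_eq_single (hne q).symm, smul_add, ← Pi.single_smul, ← Pi.single_smul]
  rw [key]
  exact G.sum_mem fun q _ => smul_mem_of_zmod_two (hG q) _

-- Pair every point with a chosen representative of its fibre. The surplus at a representative is
-- the sum over the fibre, which vanishes.
open Classical in
theorem even_smul_mem {Q T : Type} [Fintype Q] {t : Q → T}
    (ht : Function.Surjective t) {G : AddSubgroup (Q → Pauli)} {P : Pauli}
    (hG : ∀ q q', q ≠ q' → t q = t q' → linkOp q q' P ∈ G) {γ : Q → ZMod 2}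
    (hγ : γ ∈ evenFunctions t) : (fun q => γ q • P) ∈ G := by
  choose ρ hρ using ht
  have : Fintype T := Fintype.ofInjective ρ (Function.LeftInverse.injective hρ)
  have key : (fun q => γ q • P)
      = ∑ q, γ q • (Pi.single q P + Pi.single (ρ (t q)) P : Q → Pauli) := by
    have h1 : (fun q => γ q • P) = ∑ q, Pi.single q (γ q • P) :=
      (Finset.univ_sum_single (fun q => γ q • P)).symm
    have h2 : ∑ q, γ q • (Pi.single (ρ (t q)) P : Q → Pauli) = 0 := by
      rw [← Finset.sum_fiberwise (s := Finset.univ) (g := t)]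
      refine Finset.sum_eq_zero fun τ _ => ?_
      rw [Finset.sum_congr rfl (g := fun q => γ q • (Pi.single (ρ τ) P : Q → Pauli))]
      · rw [← Finset.sum_smul, hγ τ, zero_smul]
      · intro q hq
        rw [(Finset.mem_filter.1 hq).2]
    simp only [smul_add]
    rw [Finset.sum_add_distrib, h2, add_zero, h1]
    refine Finset.sum_congr rfl fun q _ => ?_
    rw [← Pi.single_smul]
  rw [key]
  refine G.sum_mem fun q _ => smul_mem_of_zmod_two ?_ _
  rcases eq_or_ne q (ρ (t q)) with h | h
  -- A representative is paired with itself; this term is no link operator, but it is zero.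
  · have h2 : ∀ x : Pauli, x + x = 0 := by decide
    rw [← h, show (Pi.single q P + Pi.single q P : Q → Pauli) = 0 from funext fun _ => h2 _]
    exact G.zero_mem
  · rw [← linkOp_eq_single h]
    exact hG _ _ h (hρ _).symm

theorem indicator_mem_invariantFunctions {Q : Type} {a : Q → Q} (ha : ∀ q, a (a q) = q) (q : Q)
    [DecidableEq Q] : (fun x => if x = q ∨ x = a q then 1 else 0) ∈ invariantFunctions a := by
  intro x
  have : (a x = q ∨ a x = a q) ↔ (x = q ∨ x = a q) := by
    constructor
    · rintro (h | h)
      · right; rw [← h, ha]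
      · left; rw [← ha x, h, ha]
    · rintro (rfl | rfl)
      · exact Or.inr rfl
      · left; rw [ha]
  simp only [this]

-- With `X = (1, 0)`, `Y = (1, 1)` and `Z = (0, 1)`, the normal form is `α X + β Y + γ Z`.
open Classical in
theorem mem_matchingGauge {Q T : Type} [Fintype Q] {a b : Q → Q} {t : Q → T}
    (ha : ∀ q, a (a q) = q) (hne : ∀ q, a q ≠ q) (hb : ∀ q, b (b q) = q) (hbne : ∀ q, b q ≠ q)
    (ht : Function.Surjective t) {g : Q → Pauli} :
    g ∈ matchingGauge a b t ↔ ∃ α ∈ invariantFunctions a, ∃ β ∈ invariantFunctions b,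
      ∃ γ ∈ evenFunctions t, g = fun q => (α q + β q, β q + γ q) := by
  constructor
  · intro hg
    induction hg using AddSubgroup.closure_induction with
    | mem g hg =>
      rcases hg with (⟨q, rfl⟩ | ⟨q, rfl⟩) | ⟨u, v, huv, h, rfl⟩
      · refine ⟨_, indicator_mem_invariantFunctions ha q, 0, zero_mem _, 0, zero_mem _, ?_⟩
        ext1 x
        by_cases h : x = q ∨ x = a q <;> simp [linkOp, h, pauliX, Prod.zero_eq_mk]
      · refine ⟨0, zero_mem _, _, indicator_mem_invariantFunctions hb q, 0, zero_mem _, ?_⟩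
        ext1 x
        by_cases h : x = q ∨ x = b q <;> simp [linkOp, h, pauliY, Prod.zero_eq_mk]
      · refine ⟨0, zero_mem _, 0, zero_mem _, Pi.single u 1 + Pi.single v 1, ?_, ?_⟩
        · intro τ
          simp only [Pi.add_apply, Finset.sum_add_distrib, Finset.sum_filter]
          have hs : ∀ w : Q, ∑ q, (if t q = τ then (Pi.single w 1 : Q → ZMod 2) q else 0)
              = if t w = τ then 1 else 0 := by
            intro w
            rw [Finset.sum_eq_single w]
            · simp
            · intro q _ hq
              simp [hq]
            · simp
          rw [hs, hs, h, CharTwo.add_self_eq_zero]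
        · rw [linkOp_eq_single huv]
          ext1 x
          rcases eq_or_ne x u with rfl | hu
          · simp [huv, pauliZ]
          · rcases eq_or_ne x v with rfl | hv
            · simp [hu, pauliZ]
            · simp [hu, hv, Prod.zero_eq_mk]
    | zero => exact ⟨0, zero_mem _, 0, zero_mem _, 0, zero_mem _, by ext1; simp [Prod.zero_eq_mk]⟩
    | add x y _ _ hx hy =>
      obtain ⟨α, hα, β, hβ, γ, hγ, rfl⟩ := hx
      obtain ⟨α', hα', β', hβ', γ', hγ', rfl⟩ := hy
      refine ⟨_, add_mem hα hα', _, add_mem hβ hβ', _, add_mem hγ hγ', ?_⟩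
      ext1 q
      simp only [Pi.add_apply, Prod.mk_add_mk, Prod.mk.injEq]
      constructor <;> ring
    | neg x _ hx =>
      obtain ⟨α, hα, β, hβ, γ, hγ, rfl⟩ := hx
      refine ⟨_, neg_mem hα, _, neg_mem hβ, _, neg_mem hγ, ?_⟩
      ext1 q
      simp only [Pi.neg_apply, Prod.neg_mk, Prod.mk.injEq]
      constructor <;> ring
  · rintro ⟨α, hα, β, hβ, γ, hγ, rfl⟩
    have h1 := invariant_smul_mem (G := matchingGauge a b t) (P := pauliX) ha hne
      (fun q => AddSubgroup.subset_closure (Or.inl (Or.inl ⟨q, rfl⟩))) hα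
    have h2 := invariant_smul_mem (G := matchingGauge a b t) (P := pauliY) hb hbne
      (fun q => AddSubgroup.subset_closure (Or.inl (Or.inr ⟨q, rfl⟩))) hβ
    have h3 := even_smul_mem (G := matchingGauge a b t) (P := pauliZ) ht
      (fun q q' hq h => AddSubgroup.subset_closure (Or.inr ⟨q, q', hq, h, rfl⟩)) hγ
    convert add_mem (add_mem h1 h2) h3 using 1
    ext1 q
    simp [pauliX, pauliY, pauliZ]

/-- The order of the gauge group, by rank and nullity: the relations between the generators are the
functions which are constant on the pairs of both matchings and even on the fibres of `t`. -/
theorem card_matchingGauge {Q T : Type} [Fintype Q] [Finite T] {a b : Q → Q} {t : Q → T}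
    (ha : ∀ q, a (a q) = q) (hne : ∀ q, a q ≠ q) (hb : ∀ q, b (b q) = q) (hbne : ∀ q, b q ≠ q)
    (ht : Function.Surjective t) :
    Nat.card (matchingGauge a b t) *
      Nat.card ↥(invariantFunctions a ⊓ invariantFunctions b ⊓ evenFunctions t) *
        2 ^ Nat.card T = 2 ^ (2 * Nat.card Q) := by
  let f : (invariantFunctions a × invariantFunctions b × evenFunctions t) →+ (Q → Pauli) :=
    { toFun := fun p q => (p.1.1 q + p.2.1.1 q, p.2.1.1 q + p.2.2.1 q)
      map_zero' := by ext1; simp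
      map_add' := fun x y => by
        ext1 q
        simp only [Prod.fst_add, Prod.snd_add, AddSubgroup.coe_add, Pi.add_apply, Prod.mk_add_mk,
          Prod.mk.injEq]
        constructor <;> ring }
  have hrange : f.range = matchingGauge a b t := by
    ext g
    rw [mem_matchingGauge ha hne hb hbne ht]
    constructor
    · rintro ⟨⟨α, β, γ⟩, rfl⟩
      exact ⟨α, α.2, β, β.2, γ, γ.2, rfl⟩
    · rintro ⟨α, hα, β, hβ, γ, hγ, rfl⟩
      exact ⟨⟨⟨α, hα⟩, ⟨β, hβ⟩, ⟨γ, hγ⟩⟩, rfl⟩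
  -- The two Pauli components give `α = β` and `β = γ`, so the kernel is the diagonal copy of the
  -- triple intersection.
  have hmem : ∀ p, p ∈ f.ker → p.1.1 = p.2.1.1 ∧ p.2.2.1 = p.2.1.1 := by
    intro p hp
    have h : ∀ q, (p.1.1 q + p.2.1.1 q, p.2.1.1 q + p.2.2.1 q) = (0 : Pauli) := congrFun hp
    constructor
    · ext1 q
      exact CharTwo.add_eq_zero.1 (congrArg Prod.fst (h q))
    · ext1 q
      exact (CharTwo.add_eq_zero.1 (congrArg Prod.snd (h q))).symm
  have hker : Nat.card f.ker =
      Nat.card ↥(invariantFunctions a ⊓ invariantFunctions b ⊓ evenFunctions t) := by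
    refine Nat.card_congr ⟨fun p => ⟨p.1.2.1.1, ⟨?_, p.1.2.1.2⟩, ?_⟩,
      fun s => ⟨⟨⟨s.1, s.2.1.1⟩, ⟨s.1, s.2.1.2⟩, ⟨s.1, s.2.2⟩⟩, ?_⟩, ?_, ?_⟩
    · rw [← (hmem p.1 p.2).1]; exact p.1.1.2
    · rw [← (hmem p.1 p.2).2]; exact p.1.2.2.2
    · change (fun q => (s.1 q + s.1 q, s.1 q + s.1 q)) = (0 : Q → Pauli)
      ext1 q
      rw [CharTwo.add_self_eq_zero]
      rfl
    · rintro ⟨⟨α, β, γ⟩, hp⟩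
      obtain ⟨h1, h2⟩ := hmem _ hp
      exact Subtype.ext (Prod.ext (Subtype.ext h1.symm) (Prod.ext rfl (Subtype.ext h2.symm)))
    · intro s; rfl
  have h := f.card_ker_mul_card_range
  rw [hker, hrange, Nat.card_prod, Nat.card_prod] at h
  have hA := card_invariantFunctions_sq ha hne
  have hB := card_invariantFunctions_sq hb hbne
  have hE := card_evenFunctions ht
  have hAB : Nat.card (invariantFunctions a) * Nat.card (invariantFunctions b) = 2 ^ Nat.card Q := by
    refine Nat.mul_self_inj.1 ?_
    calc _ = (Nat.card (invariantFunctions a) * Nat.card (invariantFunctions a)) *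
          (Nat.card (invariantFunctions b) * Nat.card (invariantFunctions b)) := by ring
      _ = _ := by rw [hA, hB]
  calc _ = Nat.card ↥(invariantFunctions a ⊓ invariantFunctions b ⊓ evenFunctions t) *
        Nat.card (matchingGauge a b t) * 2 ^ Nat.card T := by ring
    _ = (Nat.card (invariantFunctions a) * Nat.card (invariantFunctions b)) *
        (Nat.card (evenFunctions t) * 2 ^ Nat.card T) := by rw [h]; ring
    _ = _ := by rw [hAB, hE]; ring

/-! ### Equivalent codes -/

theorem SubsystemCode.Equivalent.card_qubit {C D : SubsystemCode} (h : C.Equivalent D) :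
    Nat.card C.Qubit = Nat.card D.Qubit := by
  obtain ⟨σ, -, -⟩ := h
  exact Nat.card_congr σ

theorem SubsystemCode.Equivalent.card_gauge {C D : SubsystemCode} (h : C.Equivalent D) :
    Nat.card C.gauge = Nat.card D.gauge := by
  obtain ⟨σ, L, h⟩ := h
  let e : (C.Qubit → Pauli) ≃ (D.Qubit → Pauli) :=
    { toFun := fun g q => L (σ.symm q) (g (σ.symm q))
      invFun := fun g q => (L q).symm (g (σ q))
      left_inv := fun g => by ext1; simp
      right_inv := fun g => by ext1; simp }
  exact Nat.card_congr (e.subtypeEquiv h)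

/-! ### Counting quotients by involutions -/

theorem card_eq_mul_of_card_fiber {X Y : Type} [Finite X] [Finite Y] (f : X → Y) {k : ℕ}
    (h : ∀ y, Nat.card {x // f x = y} = k) : Nat.card X = k * Nat.card Y := by
  have := Fintype.ofFinite Y
  rw [Nat.card_congr (Equiv.sigmaFiberEquiv f).symm, Nat.card_sigma]
  simp [h, mul_comm]

theorem card_eq_two_mul_of_involution {X Y : Type} [Finite X] {f : X → Y}
    (hf : Function.Surjective f) {σ : X → X} (hne : ∀ x, σ x ≠ x)
    (h : ∀ x y, f x = f y ↔ x = y ∨ x = σ y) : Nat.card X = 2 * Nat.card Y := by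
  have : Finite Y := Finite.of_surjective f hf
  refine card_eq_mul_of_card_fiber f fun y => ?_
  obtain ⟨y, rfl⟩ := hf y
  have : {x | f x = f y} = {y, σ y} := by
    ext x
    simp [h]
  change Nat.card ↥{x | f x = f y} = 2
  rw [this, Nat.card_coe_set_eq, Set.ncard_pair (hne y).symm]

/-! ### Orbits of flags -/

namespace EmbeddedGraph

variable (M : EmbeddedGraph)

/-- A set closed under some of the `s i` is a union of their orbits, since involutions can be
undone. This is the way to show that two cells differ. -/
theorem mem_of_cell_eq {T : Set (Fin 3)} {S : Set M.Flag} (hS : ∀ i ∈ T, ∀ φ ∈ S, M.s i φ ∈ S)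
    {φ ψ : M.Flag} (h : (Quot.mk _ φ : M.Cell T) = Quot.mk _ ψ) (hφ : φ ∈ S) : ψ ∈ S := by
  have hiff := congrArg (Quot.lift (fun χ : M.Flag => χ ∈ S) (by
    rintro x y ⟨i, hi, rfl⟩
    refine propext ⟨hS i hi x, fun h => ?_⟩
    have := hS i hi _ h
    rwa [M.invol] at this)) h
  exact hiff.mp hφ

theorem forall_of_closed {S : Set M.Flag} (hS : ∀ i, ∀ φ ∈ S, M.s i φ ∈ S) {φ : M.Flag}
    (hφ : φ ∈ S) (ψ : M.Flag) : ψ ∈ S := by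
  have hiff := congrArg (Quot.lift (fun χ : M.Flag => χ ∈ S) (by
    rintro x y ⟨i, rfl⟩
    refine propext ⟨hS i x, fun h => ?_⟩
    have := hS i _ h
    rwa [M.invol] at this)) (M.connected.elim (Quot.mk _ φ) (Quot.mk _ ψ))
  exact hiff.mp hφ

theorem mk_s {T : Set (Fin 3)} {i : Fin 3} (hi : i ∈ T) (φ : M.Flag) :
    (Quot.mk _ (M.s i φ) : M.Cell T) = Quot.mk _ φ :=
  (Quot.sound ⟨i, hi, rfl⟩).symm

theorem vertex_s_one (φ : M.Flag) : M.vertex (M.s 1 φ) = M.vertex φ := M.mk_s (by simp) φ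
theorem vertex_s_two (φ : M.Flag) : M.vertex (M.s 2 φ) = M.vertex φ := M.mk_s (by simp) φ
theorem face_s_zero (φ : M.Flag) : M.face (M.s 0 φ) = M.face φ := M.mk_s (by simp) φ
theorem face_s_one (φ : M.Flag) : M.face (M.s 1 φ) = M.face φ := M.mk_s (by simp) φ

theorem s_injective (i : Fin 3) : Function.Injective (M.s i) :=
  Function.LeftInverse.injective (M.invol i)

theorem card_vertex_le {v : M.Vertex} {S : Set M.Flag}
    (hS : ∀ i ∈ ({1, 2} : Set (Fin 3)), ∀ φ ∈ S, M.s i φ ∈ S) {φ : M.Flag} (hφ : φ ∈ S)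
    (hv : M.vertex φ = v) : Nat.card {ψ : M.Flag // M.vertex ψ = v} ≤ S.ncard := by
  have := M.finite_flag
  rw [← Nat.card_coe_set_eq]
  refine Nat.card_le_card_of_injective
    (fun ψ => (⟨ψ.1, M.mem_of_cell_eq hS (hv.trans ψ.2.symm) hφ⟩ : S)) fun x y h => ?_
  exact Subtype.ext (congrArg (fun z : S => z.1) h)

theorem le_card_vertex {v : M.Vertex} {S : Set M.Flag} (hS : ∀ φ ∈ S, M.vertex φ = v) :
    S.ncard ≤ Nat.card {ψ : M.Flag // M.vertex ψ = v} := by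
  have := M.finite_flag
  exact Set.ncard_le_ncard hS (Set.toFinite _)

theorem ncard_le_four {X : Type} (a b c d : X) : ({a, b, c, d} : Set X).ncard ≤ 4 := by
  classical
  have : ({a, b, c, d} : Set X) = (({a, b, c, d} : Finset X) : Set X) := by simp
  rw [this, Set.ncard_coe_finset]
  exact Finset.card_le_four

/-- If the degree is greater than 2, then the two rotations at the vertex are different. -/
theorem s_one_s_two_ne (φ : M.Flag) (h : 2 < M.degree (M.vertex φ)) :
    M.s 1 (M.s 2 φ) ≠ M.s 2 (M.s 1 φ) := by
  intro heq
  -- If the rotations agreed, `s 1` and `s 2` would commute at `φ` and the flags at the vertex would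
  -- be at most four, giving degree at most 2.
  have hle : Nat.card {ψ : M.Flag // M.vertex ψ = M.vertex φ} ≤ 4 := by
    refine (M.card_vertex_le (S := {φ, M.s 1 φ, M.s 2 φ, M.s 1 (M.s 2 φ)}) ?_ (by simp) rfl).trans
      (ncard_le_four _ _ _ _)
    have h1 := M.invol 1
    have h2 := M.invol 2
    rintro i (rfl | rfl) ψ (rfl | rfl | rfl | rfl) <;> simp [h1, h2, heq]
    rw [← heq]; simp [h1]
  unfold degree at h
  omega

theorem s_one_ne_s_two (φ : M.Flag) (h : 2 < M.degree (M.vertex φ)) : M.s 1 φ ≠ M.s 2 φ := by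
  intro heq
  refine M.s_one_s_two_ne φ h ?_
  rw [← heq, M.invol, heq, M.invol]

/-- At a vertex of degree 3 the flags form a hexagon under `s 1` and `s 2`. If the two alternating
paths of length three ended differently, they would yield eight distinct flags, hence degree at
least 4. -/
theorem braid_of_degree_eq_three (φ : M.Flag) (h : M.degree (M.vertex φ) = 3) :
    M.s 1 (M.s 2 (M.s 1 φ)) = M.s 2 (M.s 1 (M.s 2 φ)) := by
  by_contra hne
  have h0 := M.s_one_s_two_ne φ (by omega)
  have hl : [φ, M.s 1 φ, M.s 2 φ, M.s 1 (M.s 2 φ), M.s 2 (M.s 1 φ), M.s 1 (M.s 2 (M.s 1 φ)),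
      M.s 2 (M.s 1 (M.s 2 φ)), M.s 2 (M.s 1 (M.s 2 (M.s 1 φ)))].Nodup := by
    have i1 := M.invol 1
    have i2 := M.invol 2
    have n1 := M.ne_self 1
    have n2 := M.ne_self 2
    simp only [List.nodup_cons, List.mem_cons, List.not_mem_nil, or_false, not_or]
    grind (splits := 40)
  have hle := M.le_card_vertex (v := M.vertex φ) (S := {ψ | ψ ∈ [φ, M.s 1 φ, M.s 2 φ, M.s 1 (M.s 2 φ),
      M.s 2 (M.s 1 φ), M.s 1 (M.s 2 (M.s 1 φ)),
      M.s 2 (M.s 1 (M.s 2 φ)), M.s 2 (M.s 1 (M.s 2 (M.s 1 φ)))]}) (by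
    intro ψ hψ
    simp only [Set.mem_ofPred_eq, List.mem_cons, List.not_mem_nil, or_false] at hψ
    rcases hψ with rfl | rfl | rfl | rfl | rfl | rfl | rfl | rfl <;>
      simp only [vertex_s_one, vertex_s_two])
  classical
  rw [← List.coe_toFinset, Set.ncard_coe_finset, List.toFinset_card_of_nodup hl] at hle
  unfold degree at h
  simp only [List.length_cons, List.length_nil] at hle
  omega

end EmbeddedGraph

/-! ### Bombin's codes -/

namespace TwoColex

variable (M : TwoColex)

/-- The colour of the face of a flag. -/
def flagColor (φ : M.Flag) : Fin 3 := M.color (M.face φ)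

theorem flagColor_s_zero (φ : M.Flag) : M.flagColor (M.s 0 φ) = M.flagColor φ :=
  congrArg M.color (M.face_s_zero φ)

theorem flagColor_s_one (φ : M.Flag) : M.flagColor (M.s 1 φ) = M.flagColor φ :=
  congrArg M.color (M.face_s_one φ)

theorem flagColor_s_two_ne (φ : M.Flag) : M.flagColor (M.s 2 φ) ≠ M.flagColor φ :=
  (M.color_ne φ).symm

theorem braid (φ : M.Flag) : M.s 1 (M.s 2 (M.s 1 φ)) = M.s 2 (M.s 1 (M.s 2 φ)) :=
  M.braid_of_degree_eq_three φ (M.cubic _)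

theorem flagColor_s_two_s_one_ne (φ : M.Flag) :
    M.flagColor (M.s 2 (M.s 1 φ)) ≠ M.flagColor φ := by
  rw [← M.flagColor_s_one φ]
  exact M.flagColor_s_two_ne _

/-- By the braid relation, the second and the third face at a vertex are adjacent across the third
edge; so all three colours occur at every vertex. -/
theorem flagColor_s_two_ne_s_two_s_one (φ : M.Flag) :
    M.flagColor (M.s 2 φ) ≠ M.flagColor (M.s 2 (M.s 1 φ)) := by
  rw [← M.flagColor_s_one (M.s 2 (M.s 1 φ)), M.braid, ← M.flagColor_s_one (M.s 2 φ)]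
  exact (M.flagColor_s_two_ne _).symm

/-- The corner of the dual graph at a flag. -/
def cornerOf (φ : M.Flag) : M.dual.Corner := M.dual.corner φ

theorem cornerOf_eq_iff (φ ψ : M.Flag) :
    M.cornerOf φ = M.cornerOf ψ ↔ φ = ψ ∨ φ = M.s 1 ψ := by
  constructor
  · intro h
    refine M.dual.mem_of_cell_eq (S := {φ | φ = ψ ∨ φ = M.s 1 ψ}) ?_ h.symm (Or.inl rfl)
    rintro i rfl φ (rfl | rfl)
    · exact Or.inr rfl
    · exact Or.inl (M.invol 1 ψ)
  · rintro (rfl | rfl)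
    · rfl
    · exact M.dual.mk_s (T := {1}) rfl ψ

theorem cornerOf_s_one (φ : M.Flag) : M.cornerOf (M.s 1 φ) = M.cornerOf φ :=
  (M.cornerOf_eq_iff _ _).2 (Or.inr rfl)

theorem cornerOf_surjective : Function.Surjective M.cornerOf := Quot.mk_surjective

instance : Finite M.Flag := M.finite_flag
instance : Finite M.dual.Corner := Finite.of_surjective _ M.cornerOf_surjective
instance : Finite M.Vertex := Finite.of_surjective M.vertex Quot.mk_surjective

theorem ne_of_flagColor_ne {φ ψ : M.Flag} (h : M.flagColor φ ≠ M.flagColor ψ) :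
    M.cornerOf φ ≠ M.cornerOf ψ := by
  rw [Ne, M.cornerOf_eq_iff]
  rintro (rfl | rfl)
  · exact h rfl
  · exact h (M.flagColor_s_one _)

/-- The triangle of the dual graph in which a corner lies. -/
def triangle : M.dual.Corner → M.Vertex := Quot.lift M.vertex (by
  rintro φ _ ⟨i, rfl, rfl⟩
  exact (M.vertex_s_one φ).symm)

theorem triangle_corner (φ : M.Flag) : M.triangle (M.cornerOf φ) = M.vertex φ := rfl

theorem triangle_surjective : Function.Surjective M.triangle := by
  intro v
  obtain ⟨φ, rfl⟩ := Quot.mk_surjective v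
  exact ⟨M.cornerOf φ, rfl⟩

theorem triangle_eq_iff (q : M.dual.Corner) (φ : M.Flag) : M.triangle q = M.vertex φ ↔
    q = M.cornerOf φ ∨ q = M.cornerOf (M.s 2 φ) ∨ q = M.cornerOf (M.s 2 (M.s 1 φ)) := by
  constructor
  · obtain ⟨ψ, rfl⟩ := M.cornerOf_surjective q
    intro h
    refine M.mem_of_cell_eq (S := {ψ | M.cornerOf ψ = M.cornerOf φ ∨
      M.cornerOf ψ = M.cornerOf (M.s 2 φ) ∨
      M.cornerOf ψ = M.cornerOf (M.s 2 (M.s 1 φ))}) ?_ h.symm (Or.inl rfl)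
    rintro i (rfl | rfl) χ hχ
    · simpa only [Set.mem_ofPred_eq, M.cornerOf_s_one] using hχ
    · have hb : ∀ χ, M.s 2 (M.s 1 (M.s 2 (M.s 1 χ))) = M.s 1 (M.s 2 χ) := by
        intro χ
        rw [M.braid, M.invol]
      simp only [Set.mem_ofPred_eq, M.cornerOf_eq_iff] at hχ ⊢
      rcases hχ with (rfl | rfl) | (rfl | rfl) | (rfl | rfl)
      · simp
      · simp
      · simp [M.invol]
      · rw [← M.braid]; simp
      · simp [M.invol]
      · rw [hb]; simp
  · rintro (rfl | rfl | rfl)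
    · rfl
    · rw [triangle_corner, M.vertex_s_two]
    · rw [triangle_corner, M.vertex_s_two, M.vertex_s_one]

theorem corner_ne_s_two (φ : M.Flag) : M.cornerOf φ ≠ M.cornerOf (M.s 2 φ) :=
  M.ne_of_flagColor_ne (M.flagColor_s_two_ne φ).symm

theorem corner_ne_s_two_s_one (φ : M.Flag) : M.cornerOf φ ≠ M.cornerOf (M.s 2 (M.s 1 φ)) :=
  M.ne_of_flagColor_ne (M.flagColor_s_two_s_one_ne φ).symm

theorem corner_s_two_ne_s_two_s_one (φ : M.Flag) :
    M.cornerOf (M.s 2 φ) ≠ M.cornerOf (M.s 2 (M.s 1 φ)) :=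
  M.ne_of_flagColor_ne (M.flagColor_s_two_ne_s_two_s_one φ)

theorem card_dual_corner : Nat.card M.dual.Corner = 3 * Nat.card M.Vertex := by
  refine card_eq_mul_of_card_fiber M.triangle fun v => ?_
  obtain ⟨φ, rfl⟩ := Quot.mk_surjective v
  change Nat.card ↥{q | M.triangle q = M.vertex φ} = 3
  have : {q | M.triangle q = M.vertex φ} = {M.cornerOf φ, M.cornerOf (M.s 2 φ),
      M.cornerOf (M.s 2 (M.s 1 φ))} := by
    ext q
    exact M.triangle_eq_iff q φ
  rw [this, Nat.card_coe_set_eq, Set.ncard_eq_three]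
  exact ⟨_, _, _, M.corner_ne_s_two φ, M.corner_ne_s_two_s_one φ, M.corner_s_two_ne_s_two_s_one φ,
    rfl⟩

/-- A corner has two flags, whose edges lead to neighbours of the two other colours. Hence at each
corner exactly one of the two edges is outgoing (`δ = 1`) and the other incoming (`δ = 2`). -/
theorem exists_flag_corner_eq {δ : Fin 3} (hδ : δ ≠ 0) (q : M.dual.Corner) :
    ∃ φ, M.cornerOf φ = q ∧ M.flagColor (M.s 2 φ) = M.flagColor φ + δ := by
  obtain ⟨φ, rfl⟩ := M.cornerOf_surjective q
  have key : ∀ x y z δ : Fin 3, δ ≠ 0 → y ≠ x → z ≠ x → y ≠ z → y = x + δ ∨ z = x + δ := by decide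
  rcases key _ _ _ δ hδ (M.flagColor_s_two_ne φ) (M.flagColor_s_two_s_one_ne φ)
    (M.flagColor_s_two_ne_s_two_s_one φ) with h | h
  · exact ⟨φ, rfl, h⟩
  · exact ⟨M.s 1 φ, M.cornerOf_s_one φ, by rw [h, M.flagColor_s_one]⟩

/-- The matching of the corners by the links at the tails, or at the heads, of the edges. -/
theorem exists_partner {δ : Fin 3} (hδ : δ ≠ 0) : ∃ a : M.dual.Corner → M.dual.Corner,
    (∀ q, a (a q) = q) ∧ (∀ q, a q ≠ q) ∧
      ∀ φ, M.flagColor (M.s 2 φ) = M.flagColor φ + δ →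
        a (M.cornerOf φ) = M.cornerOf (M.s 0 φ) := by
  choose ρ hρ hρδ using M.exists_flag_corner_eq hδ
  -- The other flag `s 1 ψ` of the corner sees a neighbour of the third colour, so the flag with
  -- step `δ` is unique and the partner is well defined.
  have huniq : ∀ φ ψ, M.flagColor (M.s 2 φ) = M.flagColor φ + δ →
      M.flagColor (M.s 2 ψ) = M.flagColor ψ + δ → M.cornerOf φ = M.cornerOf ψ → φ = ψ := by
    intro φ ψ h1 h2 h
    rcases (M.cornerOf_eq_iff φ ψ).1 h with h | rfl
    · exact h
    · rw [M.flagColor_s_one, ← h2] at h1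
      exact absurd h1.symm (M.flagColor_s_two_ne_s_two_s_one ψ)
  have hs : ∀ φ, M.flagColor (M.s 2 φ) = M.flagColor φ + δ →
      M.flagColor (M.s 2 (M.s 0 φ)) = M.flagColor (M.s 0 φ) + δ := by
    intro φ h
    rw [← M.comm, M.flagColor_s_zero, M.flagColor_s_zero, h]
  have ha : ∀ φ, M.flagColor (M.s 2 φ) = M.flagColor φ + δ → ρ (M.cornerOf φ) = φ :=
    fun φ h => huniq _ _ (hρδ _) h (hρ _)
  refine ⟨fun q => M.cornerOf (M.s 0 (ρ q)), fun q => ?_, fun q h => ?_, fun φ h => ?_⟩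
  · simp only
    rw [ha _ (hs _ (hρδ q)), M.invol, hρ]
  · exact M.ne_self 0 (ρ q) (huniq _ _ (hs _ (hρδ q)) (hρδ q) (h.trans (hρ q).symm))
  · simp only
    rw [ha φ h]

theorem gauge_bombinCode {a b : M.dual.Corner → M.dual.Corner}
    (ha : ∀ φ, M.flagColor (M.s 2 φ) = M.flagColor φ + 1 →
      a (M.cornerOf φ) = M.cornerOf (M.s 0 φ))
    (hb : ∀ φ, M.flagColor (M.s 2 φ) = M.flagColor φ + 2 →
      b (M.cornerOf φ) = M.cornerOf (M.s 0 φ)) :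
    M.bombinCode.gauge = matchingGauge a b M.triangle := by
  have h12 : ∀ x y : Fin 3, x = y + 1 ↔ y = x + 2 := by decide
  refine le_antisymm ((AddSubgroup.closure_le _).2 ?_) ((AddSubgroup.closure_le _).2 ?_)
  · rintro g ((⟨φ, h, rfl⟩ | ⟨φ, h, rfl⟩) | ⟨φ, rfl⟩)
    · refine AddSubgroup.subset_closure (Or.inl (Or.inl ⟨M.cornerOf φ, ?_⟩))
      rw [ha φ h]
      rfl
    · refine AddSubgroup.subset_closure (Or.inl (Or.inr ⟨M.cornerOf φ, ?_⟩))
      rw [hb φ ((h12 _ _).1 h)]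
      rfl
    · refine AddSubgroup.subset_closure (Or.inr ⟨_, _, M.corner_ne_s_two φ, ?_, rfl⟩)
      exact (M.vertex_s_two φ).symm
  · rintro g ((⟨q, rfl⟩ | ⟨q, rfl⟩) | ⟨q, q', hne, h, rfl⟩)
    · obtain ⟨φ, rfl, h⟩ := M.exists_flag_corner_eq (δ := 1) (by decide) q
      refine AddSubgroup.subset_closure (Or.inl (Or.inl ⟨φ, h, ?_⟩))
      rw [ha φ h]
      rfl
    · obtain ⟨φ, rfl, h⟩ := M.exists_flag_corner_eq (δ := 2) (by decide) q
      refine AddSubgroup.subset_closure (Or.inl (Or.inr ⟨φ, (h12 _ _).2 h, ?_⟩))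
      rw [hb φ h]
      rfl
    -- The third corner of the triangle is reached through the other flag `s 1 φ` of the same
    -- corner.
    · have hZ : ∀ φ : M.Flag, linkOp (M.cornerOf φ) (M.cornerOf (M.s 2 φ)) pauliZ
          ∈ M.bombinCode.gauge :=
        fun φ => AddSubgroup.subset_closure (Or.inr ⟨φ, rfl⟩)
      obtain ⟨φ, rfl⟩ := M.cornerOf_surjective q
      rw [triangle_corner, eq_comm, triangle_eq_iff] at h
      rcases h with rfl | rfl | rfl
      · exact absurd rfl hne
      · exact hZ φ
      · have := hZ (M.s 1 φ)
        rwa [M.cornerOf_s_one] at this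

open Classical in
theorem sum_triangle [Fintype M.dual.Corner] (s : M.dual.Corner → ZMod 2) (φ : M.Flag) :
    ∑ q with M.triangle q = M.vertex φ, s q = s (M.cornerOf φ) + s (M.cornerOf (M.s 2 φ)) +
      s (M.cornerOf (M.s 2 (M.s 1 φ))) := by
  have : (Finset.univ.filter fun q => M.triangle q = M.vertex φ) = {M.cornerOf φ,
      M.cornerOf (M.s 2 φ), M.cornerOf (M.s 2 (M.s 1 φ))} := by
    ext q
    simp [M.triangle_eq_iff q φ]
  rw [this, Finset.sum_insert, Finset.sum_pair (M.corner_s_two_ne_s_two_s_one φ), add_assoc]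
  simp [M.corner_ne_s_two φ, M.corner_ne_s_two_s_one φ]

theorem exists_flag_zero_one : ∃ φ, M.flagColor φ = 0 ∧ M.flagColor (M.s 2 φ) = 1 := by
  obtain ⟨φ⟩ := M.nonempty_flag
  have key : ∀ x y z : Fin 3, y ≠ x → z ≠ x → y ≠ z →
      (x = 0 ∧ y = 1) ∨ (x = 0 ∧ z = 1) ∨ (y = 0 ∧ x = 1) ∨ (z = 0 ∧ x = 1) ∨
      (y = 0 ∧ z = 1) ∨ (z = 0 ∧ y = 1) := by decide
  have h21 : M.flagColor (M.s 2 (M.s 1 (M.s 2 φ))) = M.flagColor (M.s 2 (M.s 1 φ)) := by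
    rw [← M.braid, M.flagColor_s_one]
  have h12 : M.flagColor (M.s 2 (M.s 1 (M.s 2 (M.s 1 φ)))) = M.flagColor (M.s 2 φ) := by
    rw [M.braid, M.invol, M.flagColor_s_one]
  rcases key _ _ _ (M.flagColor_s_two_ne φ) (M.flagColor_s_two_s_one_ne φ)
    (M.flagColor_s_two_ne_s_two_s_one φ) with h | h | h | h | h | h
  · exact ⟨φ, h⟩
  · exact ⟨M.s 1 φ, by rwa [M.flagColor_s_one]⟩
  · exact ⟨M.s 2 φ, by rwa [M.invol]⟩
  · exact ⟨M.s 2 (M.s 1 φ), by rwa [M.invol, M.flagColor_s_one]⟩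
  · exact ⟨M.s 1 (M.s 2 φ), by rwa [M.flagColor_s_one, h21]⟩
  · exact ⟨M.s 1 (M.s 2 (M.s 1 φ)), by rwa [M.flagColor_s_one, h12]⟩

/-- The relations between the generators of Bombin's gauge group come from the three colours: a
function which is constant around the faces and even on the triangles is determined by its values
on two adjacent faces. -/
theorem card_relations [Fintype M.dual.Corner] {a b : M.dual.Corner → M.dual.Corner}
    (ha : ∀ φ, M.flagColor (M.s 2 φ) = M.flagColor φ + 1 →
      a (M.cornerOf φ) = M.cornerOf (M.s 0 φ))
    (hb : ∀ φ, M.flagColor (M.s 2 φ) = M.flagColor φ + 2 →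
      b (M.cornerOf φ) = M.cornerOf (M.s 0 φ)) :
    Nat.card ↥(invariantFunctions a ⊓ invariantFunctions b ⊓ evenFunctions M.triangle) = 4 := by
  classical
  -- Invariance under both matchings means being constant on the corners around each dual vertex,
  -- that is, on each face of the 2-colex.
  have hmem : ∀ s : M.dual.Corner → ZMod 2,
      s ∈ invariantFunctions a ⊓ invariantFunctions b ⊓ evenFunctions M.triangle ↔
      (∀ φ, s (M.cornerOf (M.s 0 φ)) = s (M.cornerOf φ)) ∧
      ∀ φ, s (M.cornerOf φ) + s (M.cornerOf (M.s 2 φ)) +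
        s (M.cornerOf (M.s 2 (M.s 1 φ))) = 0 := by
    intro s
    constructor
    · rintro ⟨⟨h1, h2⟩, h3⟩
      refine ⟨fun φ => ?_, fun φ => ?_⟩
      · have key : ∀ x y : Fin 3, y ≠ x → y = x + 1 ∨ y = x + 2 := by decide
        rcases key _ _ (M.flagColor_s_two_ne φ) with h | h
        · rw [← ha φ h]; exact h1 _
        · rw [← hb φ h]; exact h2 _
      · rw [← M.sum_triangle]
        convert h3 (M.vertex φ)
    · rintro ⟨h1, h2⟩
      refine ⟨⟨fun q => ?_, fun q => ?_⟩, fun v => ?_⟩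
      · obtain ⟨φ, rfl, h⟩ := M.exists_flag_corner_eq (δ := 1) (by decide) q
        rw [ha φ h, h1]
      · obtain ⟨φ, rfl, h⟩ := M.exists_flag_corner_eq (δ := 2) (by decide) q
        rw [hb φ h, h1]
      · obtain ⟨φ, rfl⟩ := Quot.mk_surjective v
        rw [← h2 φ, ← M.sum_triangle]
        congr!
  obtain ⟨φ₀, hφ0, hφ1⟩ := M.exists_flag_zero_one
  let cc : M.dual.Corner → Fin 3 := Quot.lift M.flagColor (by
    rintro φ _ ⟨i, rfl, rfl⟩
    exact (M.flagColor_s_one φ).symm)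
  have hcc : ∀ φ, cc (M.cornerOf φ) = M.flagColor φ := fun _ => rfl
  have hsum : ∀ (w : Fin 3 → ZMod 2) (x y z : Fin 3), y ≠ x → z ≠ x → y ≠ z →
      w x + w y + w z = w 0 + w 1 + w 2 := by
    intro w x y z
    fin_cases x <;> fin_cases y <;> fin_cases z <;> simp <;> ring
  -- Functions of the face colour with total zero are relations, because each triangle shows every
  -- colour once. The last value being the sum of the other two leaves four of them.
  have hw : ∀ w : Fin 3 → ZMod 2, w 0 + w 1 + w 2 = 0 →
      w ∘ cc ∈ invariantFunctions a ⊓ invariantFunctions b ⊓ evenFunctions M.triangle := by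
    intro w h
    rw [hmem]
    refine ⟨fun φ => ?_, fun φ => ?_⟩
    · simp only [Function.comp, hcc, M.flagColor_s_zero]
    · simp only [Function.comp, hcc]
      rw [hsum w _ _ _ (M.flagColor_s_two_ne φ) (M.flagColor_s_two_s_one_ne φ)
        (M.flagColor_s_two_ne_s_two_s_one φ), h]
  let f : ZMod 2 × ZMod 2 →
      ↥(invariantFunctions a ⊓ invariantFunctions b ⊓ evenFunctions M.triangle) :=
    fun p => ⟨![p.1, p.2, p.1 + p.2] ∘ cc, hw _ (by
      simp only [Matrix.cons_val]
      exact CharTwo.add_self_eq_zero _)⟩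
  have hf0 : ∀ p, (f p).1 (M.cornerOf φ₀) = p.1 := by
    intro p
    change ![p.1, p.2, p.1 + p.2] (M.flagColor φ₀) = p.1
    rw [hφ0]; rfl
  have hf1 : ∀ p, (f p).1 (M.cornerOf (M.s 2 φ₀)) = p.2 := by
    intro p
    change ![p.1, p.2, p.1 + p.2] (M.flagColor (M.s 2 φ₀)) = p.2
    rw [hφ1]; rfl
  have hbij : Function.Bijective f := by
    constructor
    · intro p p' h
      have h0 := hf0 p
      have h1 := hf1 p
      rw [h] at h0 h1
      exact Prod.ext (h0.symm.trans (hf0 p')) (h1.symm.trans (hf1 p'))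
    · intro s
      refine ⟨(s.1 (M.cornerOf φ₀), s.1 (M.cornerOf (M.s 2 φ₀))), ?_⟩
      rw [← sub_eq_zero]
      generalize hd : f (s.1 (M.cornerOf φ₀), s.1 (M.cornerOf (M.s 2 φ₀))) - s = d
      have hd0 : d.1 (M.cornerOf φ₀) = 0 := by
        rw [← hd]
        change (f _).1 _ - s.1 _ = 0
        rw [hf0, sub_self]
      have hd1 : d.1 (M.cornerOf (M.s 2 φ₀)) = 0 := by
        rw [← hd]
        change (f _).1 _ - s.1 _ = 0
        rw [hf1, sub_self]
      obtain ⟨h0, h2⟩ := (hmem d.1).1 d.2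
      -- The triangle relation supplies the third face at a vertex once two vanish, so vanishing on
      -- two adjacent faces spreads to all flags.
      have hall := M.forall_of_closed (S := {φ | d.1 (M.cornerOf φ) = 0 ∧
          d.1 (M.cornerOf (M.s 2 φ)) = 0}) (by
        rintro i φ ⟨h, h'⟩
        have h3 := h2 φ
        rw [h, h', zero_add, zero_add] at h3
        fin_cases i
        · refine ⟨(h0 φ).trans h, ?_⟩
          change d.1 (M.cornerOf (M.s 2 (M.s 0 φ))) = 0
          rw [← M.comm, h0, h']
        · refine ⟨?_, h3⟩
          change d.1 (M.cornerOf (M.s 1 φ)) = 0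
          rw [M.cornerOf_s_one, h]
        · refine ⟨h', ?_⟩
          change d.1 (M.cornerOf (M.s 2 (M.s 2 φ))) = 0
          rw [M.invol, h]) ⟨hd0, hd1⟩
      refine Subtype.ext (funext fun q => ?_)
      obtain ⟨φ, rfl⟩ := M.cornerOf_surjective q
      exact (hall φ).1
  rw [← Nat.card_congr (Equiv.ofBijective f hbij), Nat.card_prod, Nat.card_zmod]

theorem card_gauge_bombinCode :
    Nat.card M.bombinCode.gauge * 4 * 2 ^ Nat.card M.Vertex = 2 ^ (6 * Nat.card M.Vertex) := by
  have := Fintype.ofFinite M.dual.Corner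
  obtain ⟨a, ha, hne, haφ⟩ := M.exists_partner (δ := 1) (by decide)
  obtain ⟨b, hb, hbne, hbφ⟩ := M.exists_partner (δ := 2) (by decide)
  have h := card_matchingGauge ha hne hb hbne M.triangle_surjective
  rw [M.card_relations haφ hbφ, M.card_dual_corner, ← mul_assoc 2 3] at h
  rw [M.gauge_bombinCode haφ hbφ]
  exact h

end TwoColex

/-- This is all that is used about Bombin's codes; `t` is the number of vertices of the 2-colex. -/
theorem IsBombinCode.exists_card {C : SubsystemCode} (h : IsBombinCode C) :
    ∃ t : ℕ, Nat.card C.Qubit = 3 * t ∧ Nat.card C.gauge * 4 * 2 ^ t = 2 ^ (6 * t) := by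
  obtain ⟨M, h⟩ := h
  refine ⟨Nat.card M.Vertex, h.card_qubit.trans M.card_dual_corner, ?_⟩
  rw [h.card_gauge]
  exact M.card_gauge_bombinCode

/-! ### The gauge group of the code of a hypergraph -/

namespace Hypergraph

variable {V : Type} {H : Hypergraph V} {col : Set V → Fin 3}

/-- The three edges at a vertex have distinct colours, so each of the three colours occurs. -/
theorem IsAdmissible.exists_edge [Finite V] (hH : H.IsAdmissible) (hc : H.IsEdgeColoring col)
    (v : H.vertexSet) (c : Fin 3) : ∃ e ∈ H.edgeSet, v.1 ∈ e ∧ col e = c := by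
  have h3 := hH.trivalent v.1 v.2
  have hinj : Set.InjOn col {e ∈ H.edgeSet | v.1 ∈ e} := by
    intro e he e' he' h
    by_contra hne
    exact hc.proper e he.1 e' he'.1 hne ⟨v.1, he.2, he'.2⟩ h
  rw [← hinj.ncard_image] at h3
  have huniv : col '' {e ∈ H.edgeSet | v.1 ∈ e} = Set.univ := by
    refine Set.eq_of_subset_of_ncard_le (Set.subset_univ _) ?_
    rw [h3, Set.ncard_univ, Nat.card_fin]
  obtain ⟨e, he, hec⟩ := (Set.ext_iff.1 huniv c).2 trivial
  exact ⟨e, he.1, he.2, hec⟩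

theorem IsEdgeColoring.edge_unique (hc : H.IsEdgeColoring col) {v : V} {e e' : Set V}
    (he : e ∈ H.edgeSet) (he' : e' ∈ H.edgeSet) (hv : v ∈ e) (hv' : v ∈ e') (h : col e = col e') :
    e = e' := by
  by_contra hne
  exact hc.proper e he e' he' hne ⟨v, hv, hv'⟩ h

theorem IsAdmissible.ncard_eq_two (hH : H.IsAdmissible) (hc : H.IsEdgeColoring col) {e : Set V}
    (he : e ∈ H.edgeSet) (h : col e ≠ 2) : e.ncard = 2 :=
  (hH.rank e he).resolve_right fun h3 => h (hc.rank_three e he h3)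

theorem pair_right_unique {u v w : V} (huv : v ≠ u) (h : ({u, v} : Set V) = {u, w}) : v = w := by
  have hv : v ∈ ({u, w} : Set V) := h ▸ Set.mem_insert_of_mem _ rfl
  exact hv.resolve_left huv

/-- Since rank-3 edges all have colour `2`, the edges of colour `0`, and likewise those of colour
`1`, form a perfect matching. -/
theorem IsAdmissible.exists_partner [Finite V] (hH : H.IsAdmissible) (hc : H.IsEdgeColoring col)
    {c : Fin 3} (h2 : c ≠ 2) : ∃ a : H.vertexSet → H.vertexSet,
      (∀ v, a (a v) = v) ∧ (∀ v, a v ≠ v) ∧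
      (∀ v, {v.1, (a v).1} ∈ H.edgeSet ∧ col {v.1, (a v).1} = c) ∧
      ∀ u v : H.vertexSet, u ≠ v → {u.1, v.1} ∈ H.edgeSet → col {u.1, v.1} = c → v = a u := by
  have hex : ∀ v : H.vertexSet, ∃ w : H.vertexSet, w ≠ v ∧ {v.1, w.1} ∈ H.edgeSet ∧
      col {v.1, w.1} = c := by
    intro v
    obtain ⟨e, he, hv, hec⟩ := hH.exists_edge hc v c
    obtain ⟨x, y, hxy, rfl⟩ := Set.ncard_eq_two.1 (hH.ncard_eq_two hc he (hec ▸ h2))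
    have hx : x ∈ H.vertexSet := H.subset_vertexSet_of_mem_edgeSet' he (by simp)
    have hy : y ∈ H.vertexSet := H.subset_vertexSet_of_mem_edgeSet' he (by simp)
    rcases hv with hv | hv
    · refine ⟨⟨y, hy⟩, fun h => hxy ?_, ?_⟩
      · rw [← hv, ← h]
      · rw [hv]; exact ⟨he, hec⟩
    · rw [Set.mem_singleton_iff] at hv
      rw [Set.pair_comm] at he hec
      refine ⟨⟨x, hx⟩, fun h => hxy ?_, ?_⟩
      · rw [← hv, ← h]
      · rw [hv]; exact ⟨he, hec⟩
  choose a hne he hac using hex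
  have huniq : ∀ u v : H.vertexSet, u ≠ v → {u.1, v.1} ∈ H.edgeSet → col {u.1, v.1} = c →
      v = a u := by
    intro u v huv huve huvc
    have h := hc.edge_unique (v := u.1) huve (he u) (by simp) (by simp) (huvc.trans (hac u).symm)
    exact Subtype.ext (pair_right_unique (fun h => huv (Subtype.ext h).symm) h)
  refine ⟨a, fun v => (huniq (a v) v (hne v) ?_ ?_).symm, hne, fun v => ⟨he v, hac v⟩, huniq⟩
  · rw [Set.pair_comm]; exact he v
  · rw [Set.pair_comm]; exact hac v

open Classical in
/-- The order of the gauge group of an edge-coloured hypergraph: the relations between the generators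
form a group of functions which are constant on the edges with the colours `0` and `1` and even on
the edges with the colour `2`. -/
theorem IsAdmissible.card_gauge_code [Finite V] [Fintype H.vertexSet] (hH : H.IsAdmissible)
    (hc : H.IsEdgeColoring col) : ∃ K : AddSubgroup (H.vertexSet → ZMod 2),
      (∀ s ∈ K, (∀ u v : H.vertexSet, {u.1, v.1} ∈ H.edgeSet → col {u.1, v.1} ≠ 2 → s u = s v) ∧
        ∀ e ∈ H.edgeSet, col e = 2 → ∑ v with v.1 ∈ e, s v = 0) ∧
      Nat.card (H.code col).gauge * Nat.card K * 2 ^ Nat.card {e // e ∈ H.edgeSet ∧ col e = 2} =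
        2 ^ (2 * Nat.card H.vertexSet) := by
  obtain ⟨a, ha, hane, hae, hau⟩ := hH.exists_partner hc (c := 0) (by decide)
  obtain ⟨b, hb, hbne, hbe, hbu⟩ := hH.exists_partner hc (c := 1) (by decide)
  have hz : ∀ v : H.vertexSet, ∃ e : {e // e ∈ H.edgeSet ∧ col e = 2}, v.1 ∈ e.1 := by
    intro v
    obtain ⟨e, he, hv, hec⟩ := hH.exists_edge hc v 2
    exact ⟨⟨e, he, hec⟩, hv⟩
  -- `t` sends a vertex to its unique edge of colour `2`, which may have rank 2 or 3.
  choose t ht using hz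
  have htu : ∀ (v : H.vertexSet) (e : {e // e ∈ H.edgeSet ∧ col e = 2}), t v = e ↔ v.1 ∈ e.1 := by
    intro v e
    constructor
    · rintro rfl; exact ht v
    · intro h
      exact Subtype.ext (hc.edge_unique (t v).2.1 e.2.1 (ht v) h ((t v).2.2.trans e.2.2.symm))
  have hts : Function.Surjective t := by
    intro e
    have hne : e.1.Nonempty := by
      apply Set.nonempty_of_ncard_ne_zero
      rcases hH.rank e.1 e.2.1 with h | h <;> omega
    obtain ⟨v, hv⟩ := hne
    exact ⟨⟨v, H.subset_vertexSet_of_mem_edgeSet' e.2.1 hv⟩, (htu _ _).2 hv⟩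
  have hgauge : (H.code col).gauge = matchingGauge a b t := by
    refine le_antisymm ((AddSubgroup.closure_le _).2 ?_) ((AddSubgroup.closure_le _).2 ?_)
    · rintro g (⟨u, v, huv, he, rfl⟩ | ⟨e, he, h3, u, v, hu, hv, huv, rfl⟩)
      · have hcase : ∀ c : Fin 3, c = 0 ∨ c = 1 ∨ c = 2 := by decide
        rcases hcase (col {u.1, v.1}) with h | h | h
        · refine AddSubgroup.subset_closure (Or.inl (Or.inl ⟨u, ?_⟩))
          rw [h, ← hau u v huv he h]
          rfl
        · refine AddSubgroup.subset_closure (Or.inl (Or.inr ⟨u, ?_⟩))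
          rw [h, ← hbu u v huv he h]
          rfl
        · refine AddSubgroup.subset_closure (Or.inr ⟨u, v, huv, ?_, ?_⟩)
          · rw [(htu u ⟨_, he, h⟩).2 (by simp), (htu v ⟨_, he, h⟩).2 (by simp)]
          · rw [h]; rfl
      · have h2 := hc.rank_three e he h3
        refine AddSubgroup.subset_closure (Or.inr ⟨u, v, huv, ?_, rfl⟩)
        rw [(htu u ⟨_, he, h2⟩).2 hu, (htu v ⟨_, he, h2⟩).2 hv]
    · rintro g ((⟨u, rfl⟩ | ⟨u, rfl⟩) | ⟨u, v, huv, h, rfl⟩)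
      · refine AddSubgroup.subset_closure (Or.inl ⟨u, a u, (hane u).symm, (hae u).1, ?_⟩)
        rw [(hae u).2]; rfl
      · refine AddSubgroup.subset_closure (Or.inl ⟨u, b u, (hbne u).symm, (hbe u).1, ?_⟩)
        rw [(hbe u).2]; rfl
      · have hu : u.1 ∈ (t v).1 := h ▸ ht u
        have hv := ht v
        rcases hH.rank _ (t v).2.1 with h2 | h3
        · have heq : ({u.1, v.1} : Set V) = (t v).1 := by
            refine Set.eq_of_subset_of_ncard_le ?_ ?_
            · rintro x (rfl | rfl)
              · exact hu
              · exact hv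
            · rw [h2, Set.ncard_pair (fun h => huv (Subtype.ext h))]
          refine AddSubgroup.subset_closure (Or.inl ⟨u, v, huv, ?_, ?_⟩)
          · rw [heq]; exact (t v).2.1
          · rw [heq, (t v).2.2]; rfl
        · exact AddSubgroup.subset_closure (Or.inr ⟨_, (t v).2.1, h3, u, v, hu, hv, huv, rfl⟩)
  -- Only necessary conditions for membership in `K` are recorded: nothing beyond upper bounds on
  -- `K` and its being nonempty is needed later.
  refine ⟨invariantFunctions a ⊓ invariantFunctions b ⊓ evenFunctions t, ?_, ?_⟩
  · rintro s ⟨⟨h0, h1⟩, h2⟩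
    refine ⟨fun u v he hne => ?_, fun e he hec => ?_⟩
    · rcases eq_or_ne u v with rfl | huv
      · rfl
      have hcase : ∀ c : Fin 3, c ≠ 2 → c = 0 ∨ c = 1 := by decide
      rcases hcase _ hne with h | h
      · rw [hau u v huv he h]
        exact (h0 u).symm
      · rw [hbu u v huv he h]
        exact (h1 u).symm
    · rw [← h2 ⟨e, he, hec⟩]
      refine Finset.sum_congr (Finset.ext fun v => ?_) fun _ _ => rfl
      simp [htu]
  · rw [hgauge]
    exact card_matchingGauge (Q := H.vertexSet) ha hane hb hbne hts

end Hypergraph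

/-! ### Promoting edges of a 2-colex given by flags -/

/-- A description of the hypergraph of the new construction in terms of the embedded graph `N` whose
2-colex is used: the old vertices are the flags, the new vertices are the pairs of flags satisfying
`P` which are exchanged by `s j`, and adjacent new vertices come from flags exchanged by `s k`. -/
structure PromotionModel {V : Type} (H : Hypergraph V) where
  N : EmbeddedGraph
  j : Fin 3
  k : Fin 3
  P : N.Flag → Prop
  P_j : ∀ φ, P φ → P (N.s j φ)
  P_k : ∀ φ, P φ → P (N.s k φ)
  -- The 2-colex has no multiple edges.
  s_ne : ∀ i i' φ, i ≠ i' → N.s i φ ≠ N.s i' φ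
  j_ne_k : j ≠ k
  -- The two neighbours of a new vertex in its cycle are different.
  rot_ne : ∀ φ, P φ → N.s j (N.s k φ) ≠ N.s k (N.s j φ)
  old : N.Flag → V
  new : ∀ φ, P φ → V
  old_injective : Function.Injective old
  new_eq_iff : ∀ φ hφ ψ hψ, new φ hφ = new ψ hψ ↔ φ = ψ ∨ φ = N.s j ψ
  old_ne_new : ∀ φ ψ hψ, old φ ≠ new ψ hψ
  cases : ∀ v, (∃ φ, v = old φ) ∨ ∃ φ h, v = new φ h
  vertexSet_eq : H.vertexSet = Set.univ
  mem_edgeSet : ∀ e, e ∈ H.edgeSet ↔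
    (∃ φ i, ¬ (i = j ∧ P φ) ∧ e = {old φ, old (N.s i φ)}) ∨
    (∃ φ h, e = {old φ, old (N.s j φ), new φ h}) ∨
    (∃ φ h, e = {new φ h, new (N.s k φ) (P_k φ h)})

namespace PromotionModel

variable {V : Type} {H : Hypergraph V} (D : PromotionModel H)

open Classical in
/-- The edge of colour `i` at the old vertex `φ`. -/
noncomputable def edge (i : Fin 3) (φ : D.N.Flag) : Set V :=
  if h : i = D.j ∧ D.P φ then {D.old φ, D.old (D.N.s i φ), D.new φ h.2}
  else {D.old φ, D.old (D.N.s i φ)}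

/-- The edge between the new vertices at `φ` and at `s k φ`. -/
def newEdge (φ : D.N.Flag) (h : D.P φ) : Set V := {D.new φ h, D.new (D.N.s D.k φ) (D.P_k φ h)}

theorem mem_edgeSet_iff (e : Set V) : e ∈ H.edgeSet ↔ (∃ i φ, e = D.edge i φ) ∨
    ∃ φ h, e = D.newEdge φ h := by
  rw [D.mem_edgeSet]
  constructor
  · rintro (⟨φ, i, h, rfl⟩ | ⟨φ, h, rfl⟩ | ⟨φ, h, rfl⟩)
    · exact Or.inl ⟨i, φ, by rw [edge, dif_neg h]⟩
    · exact Or.inl ⟨D.j, φ, by rw [edge, dif_pos ⟨rfl, h⟩]⟩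
    · exact Or.inr ⟨φ, h, rfl⟩
  · rintro (⟨i, φ, rfl⟩ | ⟨φ, h, rfl⟩)
    · by_cases h : i = D.j ∧ D.P φ
      · obtain ⟨rfl, h⟩ := h
        rw [edge, dif_pos ⟨rfl, h⟩]
        exact Or.inr (Or.inl ⟨φ, h, rfl⟩)
      · rw [edge, dif_neg h]
        exact Or.inl ⟨φ, i, h, rfl⟩
    · exact Or.inr (Or.inr ⟨φ, h, rfl⟩)

theorem edge_mem (i : Fin 3) (φ : D.N.Flag) : D.edge i φ ∈ H.edgeSet :=
  (D.mem_edgeSet_iff _).2 (Or.inl ⟨i, φ, rfl⟩)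

theorem newEdge_mem (φ : D.N.Flag) (h : D.P φ) : D.newEdge φ h ∈ H.edgeSet :=
  (D.mem_edgeSet_iff _).2 (Or.inr ⟨φ, h, rfl⟩)

theorem P_j_iff (φ : D.N.Flag) : D.P (D.N.s D.j φ) ↔ D.P φ := by
  refine ⟨fun h => ?_, D.P_j φ⟩
  have := D.P_j _ h
  rwa [D.N.invol] at this

theorem new_s_j (φ : D.N.Flag) (h : D.P φ) : D.new (D.N.s D.j φ) (D.P_j φ h) = D.new φ h :=
  (D.new_eq_iff _ _ _ _).2 (Or.inr rfl)

theorem new_congr {φ ψ : D.N.Flag} (h : φ = ψ) (hφ : D.P φ) (hψ : D.P ψ) :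
    D.new φ hφ = D.new ψ hψ := (D.new_eq_iff _ _ _ _).2 (Or.inl h)

theorem edge_s (i : Fin 3) (φ : D.N.Flag) : D.edge i (D.N.s i φ) = D.edge i φ := by
  by_cases h : i = D.j ∧ D.P φ
  · obtain ⟨rfl, h⟩ := h
    rw [edge, edge, dif_pos ⟨rfl, D.P_j φ h⟩, dif_pos ⟨rfl, h⟩, D.new_s_j φ h, D.N.invol,
      Set.insert_comm]
  · have h' : ¬ (i = D.j ∧ D.P (D.N.s i φ)) := by
      rintro ⟨rfl, h'⟩
      exact h ⟨rfl, (D.P_j_iff φ).1 h'⟩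
    rw [edge, edge, dif_neg h', dif_neg h, D.N.invol, Set.pair_comm]

theorem newEdge_s_k (φ : D.N.Flag) (h : D.P φ) :
    D.newEdge (D.N.s D.k φ) (D.P_k φ h) = D.newEdge φ h := by
  rw [newEdge, newEdge, Set.pair_comm]
  rw [D.new_congr (D.N.invol D.k φ) _ h]

/-! ### Incidences between the edges and the old and new vertices -/

theorem old_mem_edge (i : Fin 3) (φ ψ : D.N.Flag) :
    D.old ψ ∈ D.edge i φ ↔ ψ = φ ∨ ψ = D.N.s i φ := by
  rw [edge]
  split_ifs with h <;> simp [D.old_injective.eq_iff, D.old_ne_new]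

theorem new_mem_edge (i : Fin 3) (φ ψ : D.N.Flag) (hψ : D.P ψ) :
    D.new ψ hψ ∈ D.edge i φ ↔ i = D.j ∧ (ψ = φ ∨ ψ = D.N.s D.j φ) := by
  rw [edge]
  split_ifs with h
  · simp [(D.old_ne_new _ _ _).symm, D.new_eq_iff, h.1]
  · simp only [Set.mem_insert_iff, Set.mem_singleton_iff, (D.old_ne_new _ _ _).symm, or_self,
      false_iff]
    rintro ⟨rfl, rfl | rfl⟩
    · exact h ⟨rfl, hψ⟩
    · exact h ⟨rfl, (D.P_j_iff φ).1 hψ⟩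

theorem old_notMem_newEdge (φ ψ : D.N.Flag) (h : D.P φ) : D.old ψ ∉ D.newEdge φ h := by
  simp [newEdge, D.old_ne_new]

theorem eq_edge_of_old_mem {e : Set V} (he : e ∈ H.edgeSet) {φ : D.N.Flag} (h : D.old φ ∈ e) :
    ∃ i, e = D.edge i φ := by
  rcases (D.mem_edgeSet_iff e).1 he with ⟨i, ψ, rfl⟩ | ⟨ψ, hψ, rfl⟩
  · rcases (D.old_mem_edge i ψ φ).1 h with rfl | rfl
    · exact ⟨i, rfl⟩
    · exact ⟨i, (D.edge_s i ψ).symm⟩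
  · exact absurd h (D.old_notMem_newEdge ψ φ hψ)

theorem newEdge_congr {φ ψ : D.N.Flag} (h : φ = ψ) (hφ : D.P φ) (hψ : D.P ψ) :
    D.newEdge φ hφ = D.newEdge ψ hψ := by
  subst h
  rfl

theorem eq_of_new_mem {e : Set V} (he : e ∈ H.edgeSet) {φ : D.N.Flag} (hφ : D.P φ)
    (h : D.new φ hφ ∈ e) : e = D.edge D.j φ ∨ e = D.newEdge φ hφ ∨
      e = D.newEdge (D.N.s D.j φ) (D.P_j φ hφ) := by
  rcases (D.mem_edgeSet_iff e).1 he with ⟨i, ψ, rfl⟩ | ⟨ψ, hψ, rfl⟩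
  · obtain ⟨rfl, rfl | rfl⟩ := (D.new_mem_edge i ψ φ hφ).1 h
    · exact Or.inl rfl
    · exact Or.inl (D.edge_s D.j ψ).symm
  · right
    rcases h with h | h
    · rcases (D.new_eq_iff _ _ _ _).1 h with rfl | rfl
      · exact Or.inl rfl
      · exact Or.inr (D.newEdge_congr (D.N.invol D.j ψ).symm _ _)
    · rcases (D.new_eq_iff _ _ _ _).1 h with rfl | rfl
      · exact Or.inl (D.newEdge_s_k ψ hψ).symm
      · refine Or.inr ?_
        rw [← D.newEdge_s_k ψ hψ]
        exact D.newEdge_congr (D.N.invol D.j _).symm _ _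

theorem edge_injective (φ : D.N.Flag) : Function.Injective fun i => D.edge i φ := by
  intro i i' h
  by_contra hne
  have hmem : D.old (D.N.s i φ) ∈ D.edge i φ := (D.old_mem_edge _ _ _).2 (Or.inr rfl)
  rw [show D.edge i φ = D.edge i' φ from h, D.old_mem_edge] at hmem
  rcases hmem with h | h
  · exact D.N.ne_self i φ h
  · exact D.s_ne i i' φ hne h

theorem edge_ne_newEdge (i : Fin 3) (φ ψ : D.N.Flag) (h : D.P ψ) : D.edge i φ ≠ D.newEdge ψ h := by
  intro heq
  refine D.old_notMem_newEdge ψ φ h ?_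
  rw [← heq]
  exact (D.old_mem_edge _ _ _).2 (Or.inl rfl)

theorem new_s_k_ne (φ : D.N.Flag) (h : D.P φ) : D.new (D.N.s D.k φ) (D.P_k φ h) ≠ D.new φ h := by
  rw [Ne, D.new_eq_iff]
  rintro (h | h)
  · exact D.N.ne_self _ _ h
  · exact D.s_ne _ _ _ D.j_ne_k.symm h

theorem new_s_k_ne_new_s_k_s_j (φ : D.N.Flag) (h : D.P φ) : D.new (D.N.s D.k φ) (D.P_k φ h) ≠
    D.new (D.N.s D.k (D.N.s D.j φ)) (D.P_k _ (D.P_j φ h)) := by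
  rw [Ne, D.new_eq_iff]
  rintro (h' | h')
  · exact D.N.ne_self D.j φ (D.N.s_injective D.k h').symm
  · refine D.rot_ne φ h ?_
    rw [h', D.N.invol]

theorem new_s_k_notMem (φ : D.N.Flag) (h : D.P φ) :
    D.new (D.N.s D.k φ) (D.P_k φ h) ∉ D.newEdge (D.N.s D.j φ) (D.P_j φ h) := by
  rintro (h' | h')
  · rw [D.new_s_j φ h] at h'
    exact D.new_s_k_ne φ h h'
  · exact D.new_s_k_ne_new_s_k_s_j φ h h'

theorem newEdge_ne (φ : D.N.Flag) (h : D.P φ) :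
    D.newEdge φ h ≠ D.newEdge (D.N.s D.j φ) (D.P_j φ h) := by
  intro heq
  refine D.new_s_k_notMem φ h ?_
  rw [← heq]
  exact Or.inr rfl

theorem ncard_newEdge (φ : D.N.Flag) (h : D.P φ) : (D.newEdge φ h).ncard = 2 :=
  Set.ncard_pair (D.new_s_k_ne φ h).symm

theorem ncard_edge_pos {φ : D.N.Flag} (h : D.P φ) : (D.edge D.j φ).ncard = 3 := by
  rw [edge, dif_pos ⟨rfl, h⟩, Set.ncard_eq_three]
  exact ⟨_, _, _, fun h => D.N.ne_self _ _ (D.old_injective h).symm, D.old_ne_new _ _ _,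
    D.old_ne_new _ _ _, rfl⟩

theorem ncard_edge_neg {i : Fin 3} {φ : D.N.Flag} (h : ¬ (i = D.j ∧ D.P φ)) :
    (D.edge i φ).ncard = 2 := by
  rw [edge, dif_neg h]
  exact Set.ncard_pair fun h => D.N.ne_self _ _ (D.old_injective h).symm

theorem eq_of_ncard_eq_three {e : Set V} (he : e ∈ H.edgeSet) (h3 : e.ncard = 3) :
    ∃ φ, D.P φ ∧ e = D.edge D.j φ := by
  rcases (D.mem_edgeSet_iff e).1 he with ⟨i, φ, rfl⟩ | ⟨φ, hφ, rfl⟩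
  · by_cases h : i = D.j ∧ D.P φ
    · obtain ⟨rfl, h⟩ := h
      exact ⟨φ, h, rfl⟩
    · rw [D.ncard_edge_neg h] at h3
      omega
  · rw [D.ncard_newEdge] at h3
    omega

/-- An old vertex lies on one edge of each colour `0`, `1`, `2` of the 2-colex; a new one lies on
its rank-3 edge and on two cycle edges. Two edges with two common vertices are excluded by `s_ne` if
one of these is old, and by `rot_ne` if both are new. Rank-3 edges are disjoint because all of them
come from the matching `s j`. -/
theorem isAdmissible (D : PromotionModel H) : H.IsAdmissible := by
  refine ⟨fun e he => ?_, fun v _ => ?_, fun e he e' he' hne => ?_, fun e he e' he' hne h3 h3' => ?_⟩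
  · rcases (D.mem_edgeSet_iff e).1 he with ⟨i, φ, rfl⟩ | ⟨φ, hφ, rfl⟩
    · by_cases h : i = D.j ∧ D.P φ
      · obtain ⟨rfl, h⟩ := h
        exact Or.inr (D.ncard_edge_pos h)
      · exact Or.inl (D.ncard_edge_neg h)
    · exact Or.inl (D.ncard_newEdge φ hφ)
  · rw [Set.ncard_eq_three]
    rcases D.cases v with ⟨φ, rfl⟩ | ⟨φ, hφ, rfl⟩
    · refine ⟨D.edge 0 φ, D.edge 1 φ, D.edge 2 φ, fun h => ?_, fun h => ?_, fun h => ?_, ?_⟩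
      · exact absurd (D.edge_injective φ h) (by decide)
      · exact absurd (D.edge_injective φ h) (by decide)
      · exact absurd (D.edge_injective φ h) (by decide)
      · ext e
        constructor
        · rintro ⟨he, h⟩
          obtain ⟨i, rfl⟩ := D.eq_edge_of_old_mem he h
          fin_cases i <;> simp
        · rintro (rfl | rfl | rfl) <;>
            exact ⟨D.edge_mem _ _, (D.old_mem_edge _ _ _).2 (Or.inl rfl)⟩
    · refine ⟨D.edge D.j φ, D.newEdge φ hφ, D.newEdge (D.N.s D.j φ) (D.P_j φ hφ),
        D.edge_ne_newEdge _ _ _ _, D.edge_ne_newEdge _ _ _ _, D.newEdge_ne φ hφ, ?_⟩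
      ext e
      constructor
      · rintro ⟨he, h⟩
        exact D.eq_of_new_mem he hφ h
      · rintro (rfl | rfl | rfl)
        · exact ⟨D.edge_mem _ _, (D.new_mem_edge _ _ _ _).2 ⟨rfl, Or.inl rfl⟩⟩
        · exact ⟨D.newEdge_mem _ _, Or.inl rfl⟩
        · exact ⟨D.newEdge_mem _ _, Or.inl (D.new_s_j φ hφ).symm⟩
  · have hold : ∀ φ, D.old φ ∈ e → D.old φ ∈ e' → ∀ y, y ∈ e → y ∈ e' → D.old φ = y := by
      intro φ h h' y hy hy'
      by_contra hxy
      obtain ⟨i, rfl⟩ := D.eq_edge_of_old_mem he h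
      obtain ⟨i', rfl⟩ := D.eq_edge_of_old_mem he' h'
      have hii : i ≠ i' := by
        rintro rfl
        exact hne rfl
      rcases D.cases y with ⟨ψ, rfl⟩ | ⟨ψ, hψ, rfl⟩
      · rcases (D.old_mem_edge _ _ _).1 hy with rfl | rfl
        · exact hxy rfl
        · rcases (D.old_mem_edge _ _ _).1 hy' with h | h
          · exact D.N.ne_self _ _ h
          · exact D.s_ne _ _ _ hii h
      · exact hii (((D.new_mem_edge _ _ _ _).1 hy).1.trans ((D.new_mem_edge _ _ _ _).1 hy').1.symm)
    rintro x ⟨hx, hx'⟩ y ⟨hy, hy'⟩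
    rcases D.cases x with ⟨φ, rfl⟩ | ⟨φ, hφ, rfl⟩
    · exact hold φ hx hx' y hy hy'
    rcases D.cases y with ⟨ψ, rfl⟩ | ⟨ψ, hψ, rfl⟩
    · exact (hold ψ hy hy' _ hx hx').symm
    by_contra hxy
    have h1 : ∀ e ∈ H.edgeSet, D.new φ hφ ∈ e → D.new ψ hψ ∈ e → e = D.newEdge φ hφ ∨
        e = D.newEdge (D.N.s D.j φ) (D.P_j φ hφ) := by
      intro e he hx hy
      rcases D.eq_of_new_mem he hφ hx with rfl | h
      · have := ((D.new_mem_edge _ _ _ _).1 hy).2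
        rw [← D.new_eq_iff ψ hψ φ hφ] at this
        exact absurd this.symm hxy
      · exact h
    have h2 : D.new ψ hψ ∈ D.newEdge φ hφ →
        D.new ψ hψ ∉ D.newEdge (D.N.s D.j φ) (D.P_j φ hφ) := by
      rintro (h | h)
      · exact absurd h.symm hxy
      · rw [Set.mem_singleton_iff] at h
        rw [h]
        exact D.new_s_k_notMem φ hφ
    rcases h1 e he hx hy with rfl | rfl <;> rcases h1 e' he' hx' hy' with rfl | rfl
    · exact hne rfl
    · exact h2 hy hy'
    · exact h2 hy' hy
    · exact hne rfl
  · obtain ⟨φ, hφ, rfl⟩ := D.eq_of_ncard_eq_three he h3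
    obtain ⟨ψ, hψ, rfl⟩ := D.eq_of_ncard_eq_three he' h3'
    rw [Set.disjoint_left]
    intro x hx hx'
    have hcong : ∀ χ θ, (χ = θ ∨ χ = D.N.s D.j θ) → D.edge D.j χ = D.edge D.j θ := by
      rintro χ θ (rfl | rfl)
      · rfl
      · exact D.edge_s _ _
    rcases D.cases x with ⟨χ, rfl⟩ | ⟨χ, hχ, rfl⟩
    · rw [D.old_mem_edge] at hx hx'
      exact hne ((hcong _ _ hx).symm.trans (hcong _ _ hx'))
    · rw [D.new_mem_edge] at hx hx'
      exact hne ((hcong _ _ hx.2).symm.trans (hcong _ _ hx'.2))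

/-! #### Colourings -/

/-- A colouring of the hypergraph which is inherited from the 2-colex. -/
structure IsColoring (col : Set V → Fin 3) (π : Equiv.Perm (Fin 3)) : Prop where
  isEdgeColoring : H.IsEdgeColoring col
  col_edge : ∀ i φ, col (D.edge i φ) = π i
  map_j : π D.j = 2

/-- If the corners at which the new vertices are adjacent have a proper 2-colouring, then there is a
colouring of the hypergraph. -/
theorem exists_coloring {π : Equiv.Perm (Fin 3)} (hπ : π D.j = 2) {χ : D.N.Flag → Bool}
    (hk : ∀ φ, χ (D.N.s D.k φ) = χ φ) (hj : ∀ φ, χ (D.N.s D.j φ) = !χ φ) :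
    ∃ col, D.IsColoring col π := by
  classical
  have huniq : ∀ i i' φ φ', D.edge i φ = D.edge i' φ' → i = i' := by
    intro i i' φ φ' h
    have hmem : D.old φ ∈ D.edge i' φ' := h ▸ (D.old_mem_edge _ _ _).2 (Or.inl rfl)
    rcases (D.old_mem_edge _ _ _).1 hmem with rfl | rfl
    · exact D.edge_injective φ h
    · rw [← D.edge_s i' φ'] at h
      exact D.edge_injective _ h
  -- A cycle edge determines its flag up to `s k`, since passing to `s j` gives the other cycle edge
  -- at the vertex; so `χ` colours the cycle edges.
  have hnew : ∀ φ h ψ h', D.newEdge φ h = D.newEdge ψ h' → χ φ = χ ψ := by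
    intro φ h ψ h' heq
    have hmem : D.new φ h ∈ D.newEdge ψ h' := heq ▸ Or.inl rfl
    rcases hmem with hmem | hmem
    · rcases (D.new_eq_iff _ _ _ _).1 hmem with rfl | rfl
      · rfl
      · exact absurd heq.symm (D.newEdge_ne ψ h')
    · rcases (D.new_eq_iff _ _ _ _).1 hmem with rfl | rfl
      · exact hk ψ
      · rw [← D.newEdge_s_k ψ h'] at heq
        exact absurd heq.symm (D.newEdge_ne _ _)
  let col : Set V → Fin 3 := fun e =>
    if h : ∃ i φ, e = D.edge i φ then π h.choose
    else if ∃ φ h, χ φ = true ∧ e = D.newEdge φ h then 0 else 1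
  have hcol : ∀ i φ, col (D.edge i φ) = π i := by
    intro i φ
    have h : ∃ i' φ', D.edge i φ = D.edge i' φ' := ⟨i, φ, rfl⟩
    change dite _ _ _ = _
    rw [dif_pos h]
    obtain ⟨φ', hφ'⟩ := h.choose_spec
    rw [← huniq _ _ _ _ hφ']
  have hcolnew : ∀ φ h, col (D.newEdge φ h) = if χ φ = true then 0 else 1 := by
    intro φ h
    have hno : ¬ ∃ i ψ, D.newEdge φ h = D.edge i ψ := by
      rintro ⟨i, ψ, heq⟩
      exact D.edge_ne_newEdge _ _ _ _ heq.symm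
    change dite _ _ _ = _
    rw [dif_neg hno]
    refine if_congr ⟨?_, fun hχ => ⟨φ, h, hχ, rfl⟩⟩ rfl rfl
    rintro ⟨ψ, h', hχ, heq⟩
    rw [hnew _ _ _ _ heq, hχ]
  refine ⟨col, ⟨fun e he e' he' hne hint => ?_, fun e he h3 => ?_⟩, hcol, hπ⟩
  · obtain ⟨x, hx, hx'⟩ := hint
    rcases D.cases x with ⟨φ, rfl⟩ | ⟨φ, hφ, rfl⟩
    · obtain ⟨i, rfl⟩ := D.eq_edge_of_old_mem he hx
      obtain ⟨i', rfl⟩ := D.eq_edge_of_old_mem he' hx'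
      rw [hcol, hcol]
      intro h
      rw [π.injective h] at hne
      exact hne rfl
    · rcases D.eq_of_new_mem he hφ hx with rfl | rfl | rfl <;>
        rcases D.eq_of_new_mem he' hφ hx' with rfl | rfl | rfl <;>
        simp only [ne_eq, not_true_eq_false] at hne <;>
        simp only [hcol, hcolnew, hπ, hj] <;> cases χ φ <;> decide
  · obtain ⟨φ, hφ, rfl⟩ := D.eq_of_ncard_eq_three he h3
    rw [hcol, hπ]

/-! #### Counting -/

variable {D} {col : Set V → Fin 3} {π : Equiv.Perm (Fin 3)}

theorem IsColoring.col_newEdge_ne (hc : D.IsColoring col π) (φ : D.N.Flag) (h : D.P φ) :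
    col (D.newEdge φ h) ≠ 2 := by
  rw [← hc.map_j, ← hc.col_edge D.j φ]
  exact hc.isEdgeColoring.proper _ (D.newEdge_mem φ h) _ (D.edge_mem _ _)
    (D.edge_ne_newEdge _ _ _ _).symm
    ⟨D.new φ h, Or.inl rfl, (D.new_mem_edge _ _ _ _).2 ⟨rfl, Or.inl rfl⟩⟩

/-- An edge of colour `2` is a pair `{φ, s j φ}`, promoted or not: cycle edges meet a rank-3 edge
and therefore avoid this colour. -/
theorem IsColoring.two_mul_card_edges (hc : D.IsColoring col π) :
    Nat.card D.N.Flag = 2 * Nat.card {e // e ∈ H.edgeSet ∧ col e = 2} := by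
  have := D.N.finite_flag
  refine card_eq_two_mul_of_involution (σ := D.N.s D.j)
    (f := fun φ => ⟨D.edge D.j φ, D.edge_mem _ _, (hc.col_edge _ _).trans hc.map_j⟩) ?_
    (D.N.ne_self D.j) fun φ ψ => ?_
  · rintro ⟨e, he, hec⟩
    rcases (D.mem_edgeSet_iff e).1 he with ⟨i, φ, rfl⟩ | ⟨φ, hφ, rfl⟩
    · rw [hc.col_edge, ← hc.map_j] at hec
      obtain rfl := π.injective hec
      exact ⟨φ, rfl⟩
    · exact absurd hec (hc.col_newEdge_ne φ hφ)
  · rw [Subtype.mk.injEq]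
    constructor
    · intro h
      rw [← D.old_mem_edge, ← h, D.old_mem_edge]
      exact Or.inl rfl
    · rintro (rfl | rfl)
      · rfl
      · exact D.edge_s _ _

variable (D)

theorem two_mul_card_vertexSet [Finite V] : 2 * Nat.card H.vertexSet =
    2 * Nat.card D.N.Flag + Nat.card {φ // D.P φ} := by
  have := D.N.finite_flag
  have h1 : Nat.card {φ // D.P φ} = 2 * Nat.card {v // ∃ φ h, v = D.new φ h} := by
    refine card_eq_two_mul_of_involution (σ := fun φ => ⟨D.N.s D.j φ.1, D.P_j _ φ.2⟩)
      (f := fun φ => ⟨D.new φ.1 φ.2, φ.1, φ.2, rfl⟩) ?_ (fun φ h => ?_) fun φ ψ => ?_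
    · rintro ⟨v, φ, h, rfl⟩
      exact ⟨⟨φ, h⟩, rfl⟩
    · exact D.N.ne_self _ _ (congrArg Subtype.val h)
    · rw [Subtype.mk.injEq, D.new_eq_iff, Subtype.ext_iff, Subtype.ext_iff]
  let f : D.N.Flag ⊕ {v // ∃ φ h, v = D.new φ h} → V := Sum.elim D.old Subtype.val
  have hf : Function.Bijective f := by
    constructor
    · rintro (x | ⟨_, x, hx, rfl⟩) (y | ⟨_, y, hy, rfl⟩) h
      · exact congrArg Sum.inl (D.old_injective h)
      · exact absurd h (D.old_ne_new _ _ _)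
      · exact absurd h.symm (D.old_ne_new _ _ _)
      · exact congrArg Sum.inr (Subtype.ext h)
    · intro v
      rcases D.cases v with ⟨φ, rfl⟩ | h
      · exact ⟨Sum.inl φ, rfl⟩
      · exact ⟨Sum.inr ⟨v, h⟩, rfl⟩
  have h2 : Nat.card H.vertexSet = Nat.card V := by
    rw [D.vertexSet_eq, Nat.card_univ]
  rw [h2, ← Nat.card_congr (Equiv.ofBijective f hf), Nat.card_sum, h1]
  ring

variable {D}

/-- The order of the gauge group, in terms of the embedded graph. -/
theorem IsColoring.card_gauge_code [Finite V] (hc : D.IsColoring col π) :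
    ∃ K : AddSubgroup (V → ZMod 2),
      (∀ s ∈ K, (∀ i φ, i ≠ D.j → s (D.old (D.N.s i φ)) = s (D.old φ)) ∧
        (∀ φ h, s (D.new (D.N.s D.k φ) (D.P_k φ h)) = s (D.new φ h)) ∧
        ∀ φ h, s (D.old φ) + s (D.old (D.N.s D.j φ)) + s (D.new φ h) = 0) ∧
      ∃ n t, Nat.card (H.code col).Qubit = n ∧
        2 * n = 2 * Nat.card D.N.Flag + Nat.card {φ // D.P φ} ∧
        Nat.card D.N.Flag = 2 * t ∧
        Nat.card (H.code col).gauge * Nat.card K * 2 ^ t = 2 ^ (2 * n) := by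
  classical
  have := Fintype.ofFinite H.vertexSet
  obtain ⟨K, hK, hcard⟩ := D.isAdmissible.card_gauge_code hc.isEdgeColoring
  have hV : ∀ v, v ∈ H.vertexSet := fun v => D.vertexSet_eq ▸ Set.mem_univ v
  let F : (V → ZMod 2) ≃+ (H.vertexSet → ZMod 2) :=
    { toFun := fun s v => s v.1
      invFun := fun s v => s ⟨v, hV v⟩
      left_inv := fun _ => rfl
      right_inv := fun _ => rfl
      map_add' := fun _ _ => rfl }
  refine ⟨K.comap F.toAddMonoidHom, fun s hs => ?_, _, _, rfl, D.two_mul_card_vertexSet,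
    hc.two_mul_card_edges, ?_⟩
  · obtain ⟨h1, h2⟩ := hK _ hs
    refine ⟨fun i φ hi => ?_, fun φ h => ?_, fun φ h => ?_⟩
    · have heq : ({D.old (D.N.s i φ), D.old φ} : Set V) = D.edge i φ := by
        rw [edge, dif_neg (fun h => hi h.1), Set.pair_comm]
      refine h1 ⟨_, hV _⟩ ⟨_, hV _⟩ (heq ▸ D.edge_mem i φ) ?_
      change col {D.old (D.N.s i φ), D.old φ} ≠ 2
      rw [heq, hc.col_edge, ← hc.map_j]
      exact fun h => hi (π.injective h)
    · have heq : ({D.new (D.N.s D.k φ) (D.P_k φ h), D.new φ h} : Set V) = D.newEdge φ h := by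
        rw [newEdge, Set.pair_comm]
      refine h1 ⟨_, hV _⟩ ⟨_, hV _⟩ (heq ▸ D.newEdge_mem φ h) ?_
      change col {D.new (D.N.s D.k φ) (D.P_k φ h), D.new φ h} ≠ 2
      rw [heq]
      exact hc.col_newEdge_ne φ h
    · have h3 := h2 _ (D.edge_mem D.j φ) ((hc.col_edge _ _).trans hc.map_j)
      rw [edge, dif_pos ⟨rfl, h⟩] at h3
      have h4 : ∑ v ∈ ({⟨D.old φ, hV _⟩, ⟨D.old (D.N.s D.j φ), hV _⟩, ⟨D.new φ h, hV _⟩} :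
          Finset H.vertexSet), s v.1 = 0 := by
        rw [← h3]
        exact Finset.sum_congr (Finset.ext fun v => by simp [Subtype.ext_iff]) fun _ _ => rfl
      rw [Finset.sum_insert, Finset.sum_pair, ← add_assoc] at h4
      · exact h4
      · exact fun h => D.old_ne_new _ _ _ (congrArg Subtype.val h)
      · simp only [Finset.mem_insert, Finset.mem_singleton, Subtype.mk.injEq, not_or]
        exact ⟨fun h => D.N.ne_self _ _ (D.old_injective h).symm, D.old_ne_new _ _ _⟩
  · refine Eq.trans ?_ hcard
    congr 2
    exact Nat.card_congr (F.toEquiv.subtypeEquiv fun _ => Iff.rfl)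

end PromotionModel

/-! ### Promotions in the 2-colex of an embedded graph -/

namespace EmbeddedGraph

variable (N : EmbeddedGraph)

/-- A flag of the 2-colex. -/
def colexFlag (φ : N.Flag) (π : Equiv.Perm (Fin 3)) : N.colex.Flag := (φ, π)

theorem exists_colexFlag (x : N.colex.Flag) : ∃ φ π, x = N.colexFlag φ π := ⟨x.1, x.2, rfl⟩

theorem colex_s_zero (φ : N.Flag) (π : Equiv.Perm (Fin 3)) :
    N.colex.s 0 (N.colexFlag φ π) = N.colexFlag (N.s (π 0) φ) π := rfl

theorem colex_s_one (φ : N.Flag) (π : Equiv.Perm (Fin 3)) :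
    N.colex.s 1 (N.colexFlag φ π) = N.colexFlag φ (π * Equiv.swap 0 1) := rfl

theorem colex_s_two (φ : N.Flag) (π : Equiv.Perm (Fin 3)) :
    N.colex.s 2 (N.colexFlag φ π) = N.colexFlag φ (π * Equiv.swap 1 2) := rfl

theorem colex_color (φ : N.Flag) (π : Equiv.Perm (Fin 3)) :
    N.colex.color (N.colex.face (N.colexFlag φ π)) = π 2 := rfl

theorem colex_color_s_two (φ : N.Flag) (π : Equiv.Perm (Fin 3)) :
    N.colex.color (N.colex.face (N.colex.s 2 (N.colexFlag φ π))) = π 1 := by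
  rw [colex_s_two, colex_color, Equiv.Perm.mul_apply, Equiv.swap_apply_right]

theorem colex_edgeColor (φ : N.Flag) (π : Equiv.Perm (Fin 3)) :
    N.colex.edgeColor (N.colexFlag φ π) = π 0 := by
  rw [TwoColex.edgeColor, colex_color_s_two, colex_color]
  revert π
  decide

/-- Turning to the other boundary edge at the vertex, crossing it and turning back moves along the
face by the edge of colour `π 1`. This leads from one promoted edge to the next. -/
theorem colex_s_one_zero_one (φ : N.Flag) (π : Equiv.Perm (Fin 3)) :
    N.colex.s 1 (N.colex.s 0 (N.colex.s 1 (N.colexFlag φ π))) = N.colexFlag (N.s (π 1) φ) π := by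
  rw [colex_s_one, colex_s_zero, colex_s_one, Equiv.Perm.mul_apply, Equiv.swap_apply_left,
    mul_assoc, Equiv.swap_mul_self, mul_one]

theorem colex_vertex_eq_iff (φ ψ : N.Flag) (π τ : Equiv.Perm (Fin 3)) :
    N.colex.vertex (N.colexFlag φ π) = N.colex.vertex (N.colexFlag ψ τ) ↔ φ = ψ :=
  N.flagMap_vertex_eq φ ψ π τ

theorem colex_edge_eq_iff (φ ψ : N.Flag) (π τ : Equiv.Perm (Fin 3)) :
    N.colex.edge (N.colexFlag φ π) = N.colex.edge (N.colexFlag ψ τ) ↔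
      π 0 = τ 0 ∧ (φ = ψ ∨ φ = N.s (τ 0) ψ) := by
  constructor
  · intro h
    have hS := N.colex.mem_of_cell_eq (T := {0, 2})
      (S := {x | x.2 0 = τ 0 ∧ (x.1 = ψ ∨ x.1 = N.s (τ 0) ψ)}) ?_ h.symm ⟨rfl, Or.inl rfl⟩
    · exact hS
    · rintro i (rfl | rfl) ⟨χ, σ⟩ ⟨h0, hχ⟩
      · change σ 0 = τ 0 at h0
        refine ⟨h0, ?_⟩
        change N.s (σ 0) χ = ψ ∨ N.s (σ 0) χ = N.s (τ 0) ψ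
        rw [h0]
        rcases hχ with rfl | rfl
        · exact Or.inr rfl
        · exact Or.inl (N.invol _ _)
      · refine ⟨?_, hχ⟩
        change (σ * Equiv.swap 1 2 : Equiv.Perm (Fin 3)) 0 = τ 0
        rw [Equiv.Perm.mul_apply, show (Equiv.swap 1 2 : Equiv.Perm (Fin 3)) 0 = 0 by decide]
        exact h0
  · rintro ⟨h0, h⟩
    have h1 : N.colex.edge (N.colexFlag ψ π) = N.colex.edge (N.colexFlag ψ τ) := by
      have key : ∀ π τ : Equiv.Perm (Fin 3), π 0 = τ 0 → π = τ ∨ π = τ * Equiv.swap 1 2 := by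
        decide
      rcases key π τ h0 with rfl | rfl
      · rfl
      · exact N.colex.mk_s (T := {0, 2}) (i := 2) (by simp) (N.colexFlag ψ τ)
    rw [← h1]
    rcases h with rfl | rfl
    · rfl
    · rw [← h0, ← colex_s_zero]
      exact N.colex.mk_s (T := {0, 2}) (i := 0) (by simp) (N.colexFlag ψ π)

end EmbeddedGraph

/-- The promoted edges are the edges of colour `j` on the faces at the flags satisfying `P`, and the
other edges of these faces have colour `k`. -/
structure Promotion.IsGivenBy {N : EmbeddedGraph} (D : Promotion N.colex) (j k : Fin 3)
    (P : N.Flag → Prop) : Prop where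
  P_j : ∀ φ, P φ → P (N.s j φ)
  P_k : ∀ φ, P φ → P (N.s k φ)
  j_ne_k : j ≠ k
  s_ne : ∀ i i' φ, i ≠ i' → N.s i φ ≠ N.s i' φ
  rot_ne : ∀ φ, P φ → N.s j (N.s k φ) ≠ N.s k (N.s j φ)
  isPromoted_iff : ∀ φ π, D.IsPromoted (N.colexFlag φ π) ↔ P φ ∧ π 0 = j ∧ π 1 = k

namespace Promotion

variable {N : EmbeddedGraph} {D : Promotion N.colex} {j k : Fin 3} {P : N.Flag → Prop}

theorem exists_perm (h : j ≠ k) : ∃ τ : Equiv.Perm (Fin 3), τ 0 = j ∧ τ 1 = k := by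
  revert j k
  decide

theorem IsGivenBy.exists_promoted_iff (hD : D.IsGivenBy j k P) (φ : N.Flag)
    (π : Equiv.Perm (Fin 3)) :
    (∃ ψ, N.colex.edge ψ = N.colex.edge (N.colexFlag φ π) ∧ D.IsPromoted ψ) ↔ π 0 = j ∧ P φ := by
  constructor
  · rintro ⟨x, hx, hP⟩
    obtain ⟨ψ, τ, rfl⟩ := N.exists_colexFlag x
    obtain ⟨hψ, h0, -⟩ := (hD.isPromoted_iff ψ τ).1 hP
    obtain ⟨h1, h2⟩ := (N.colex_edge_eq_iff _ _ _ _).1 hx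
    refine ⟨h1.symm.trans h0, ?_⟩
    rcases h2 with rfl | rfl
    · exact hψ
    · rw [← h1, h0] at hψ
      have := hD.P_j _ hψ
      rwa [N.invol] at this
  · rintro ⟨h0, hφ⟩
    obtain ⟨τ, hτ⟩ := exists_perm hD.j_ne_k
    exact ⟨N.colexFlag φ τ, (N.colex_edge_eq_iff _ _ _ _).2 ⟨hτ.1.trans h0.symm, Or.inl rfl⟩,
      (hD.isPromoted_iff φ τ).2 ⟨hφ, hτ⟩⟩

theorem promotedEdge_eq_iff (φ ψ : N.colex.Flag) (hφ : D.IsPromoted φ) (hψ : D.IsPromoted ψ) :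
    D.promotedEdge φ hφ = D.promotedEdge ψ hψ ↔ N.colex.edge φ = N.colex.edge ψ :=
  Subtype.ext_iff

/-- The old vertex at a flag. -/
def oldVertex (D : Promotion N.colex) (φ : N.Flag) : D.HVertex :=
  Sum.inl (N.colex.vertex (N.colexFlag φ 1))

theorem inl_vertex (D : Promotion N.colex) (φ : N.Flag) (π : Equiv.Perm (Fin 3)) :
    (Sum.inl (N.colex.vertex (N.colexFlag φ π)) : D.HVertex) = D.oldVertex φ :=
  congrArg Sum.inl ((N.colex_vertex_eq_iff φ φ π 1).2 rfl)

theorem oldEdge_eq (D : Promotion N.colex) (φ : N.Flag) (π : Equiv.Perm (Fin 3)) :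
    D.oldEdge (N.colexFlag φ π) = {D.oldVertex φ, D.oldVertex (N.s (π 0) φ)} := by
  rw [oldEdge, N.colex_s_zero, inl_vertex, inl_vertex]

/-- The new vertex at a flag. -/
noncomputable def IsGivenBy.newVertex (hD : D.IsGivenBy j k P) (φ : N.Flag) (h : P φ) : D.HVertex :=
  Sum.inr (D.promotedEdge (N.colexFlag φ (exists_perm hD.j_ne_k).choose)
    ((hD.isPromoted_iff _ _).2 ⟨h, (exists_perm hD.j_ne_k).choose_spec⟩))

theorem IsGivenBy.inr_promotedEdge (hD : D.IsGivenBy j k P) (φ : N.Flag)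
    (π : Equiv.Perm (Fin 3)) (h : D.IsPromoted (N.colexFlag φ π)) :
    Sum.inr (D.promotedEdge _ h) = hD.newVertex φ ((hD.isPromoted_iff _ _).1 h).1 :=
  congrArg Sum.inr (Subtype.ext ((N.colex_edge_eq_iff _ _ _ _).2
    ⟨((hD.isPromoted_iff _ _).1 h).2.1.trans (exists_perm hD.j_ne_k).choose_spec.1.symm,
      Or.inl rfl⟩))

theorem IsGivenBy.rankThreeEdge_eq (hD : D.IsGivenBy j k P) (φ : N.Flag)
    (π : Equiv.Perm (Fin 3)) (h : D.IsPromoted (N.colexFlag φ π)) :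
    D.rankThreeEdge _ h = {D.oldVertex φ, D.oldVertex (N.s j φ),
      hD.newVertex φ ((hD.isPromoted_iff _ _).1 h).1} := by
  rw [rankThreeEdge, hD.inr_promotedEdge, inl_vertex, N.colex_s_zero, inl_vertex]
  exact congrArg (fun i => ({D.oldVertex φ, D.oldVertex (N.s i φ), hD.newVertex φ _} : Set D.HVertex))
    ((hD.isPromoted_iff _ _).1 h).2.1

/-- The hypergraph of a promotion in terms of the flags of the embedded graph. -/
noncomputable def IsGivenBy.model (hD : D.IsGivenBy j k P) : PromotionModel D.hypergraph where
  N := N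
  j := j
  k := k
  P := P
  P_j := hD.P_j
  P_k := hD.P_k
  s_ne := hD.s_ne
  j_ne_k := hD.j_ne_k
  rot_ne := hD.rot_ne
  old := D.oldVertex
  new := hD.newVertex
  old_injective φ ψ h := (N.colex_vertex_eq_iff φ ψ 1 1).1 (Sum.inl_injective h)
  new_eq_iff φ hφ ψ hψ := by
    rw [newVertex, newVertex, Sum.inr.injEq, promotedEdge_eq_iff, N.colex_edge_eq_iff,
      (exists_perm hD.j_ne_k).choose_spec.1]
    exact and_iff_right rfl
  old_ne_new φ ψ hψ h := Sum.inl_ne_inr h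
  cases v := by
    rcases v with v | ⟨e, x, rfl, hx⟩
    · obtain ⟨x, rfl⟩ := Quot.mk_surjective v
      obtain ⟨φ, π, rfl⟩ := N.exists_colexFlag x
      exact Or.inl ⟨φ, D.inl_vertex φ π⟩
    · obtain ⟨φ, π, rfl⟩ := N.exists_colexFlag x
      exact Or.inr ⟨φ, _, hD.inr_promotedEdge φ π hx⟩
  vertexSet_eq := rfl
  mem_edgeSet e := by
    obtain ⟨τ, hτ⟩ := exists_perm hD.j_ne_k
    constructor
    · rintro ((⟨x, hx, rfl⟩ | ⟨x, hx, rfl⟩) | ⟨x, hx, hx', rfl⟩)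
      · obtain ⟨φ, π, rfl⟩ := N.exists_colexFlag x
        rw [hD.exists_promoted_iff] at hx
        exact Or.inl ⟨φ, π 0, hx, D.oldEdge_eq φ π⟩
      · obtain ⟨φ, π, rfl⟩ := N.exists_colexFlag x
        exact Or.inr (Or.inl ⟨φ, _, hD.rankThreeEdge_eq φ π hx⟩)
      · obtain ⟨φ, π, rfl⟩ := N.exists_colexFlag x
        obtain ⟨hφ, h0, h1⟩ := (hD.isPromoted_iff _ _).1 hx
        refine Or.inr (Or.inr ⟨φ, hφ, ?_⟩)
        simp only [N.colex_s_one_zero_one, hD.inr_promotedEdge, h1]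
    · rintro (⟨φ, i, h, rfl⟩ | ⟨φ, h, rfl⟩ | ⟨φ, h, rfl⟩)
      · refine Or.inl (Or.inl ⟨N.colexFlag φ (Equiv.swap 0 i), ?_, ?_⟩)
        · rwa [hD.exists_promoted_iff, Equiv.swap_apply_left]
        · rw [D.oldEdge_eq, Equiv.swap_apply_left]
      · exact Or.inl (Or.inr ⟨N.colexFlag φ τ, (hD.isPromoted_iff _ _).2 ⟨h, hτ⟩,
          (hD.rankThreeEdge_eq φ τ _).symm⟩)
      · refine Or.inr ⟨N.colexFlag φ τ, (hD.isPromoted_iff _ _).2 ⟨h, hτ⟩, ?_, ?_⟩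
        · rw [N.colex_s_one_zero_one, hτ.2]
          exact (hD.isPromoted_iff _ _).2 ⟨hD.P_k φ h, hτ⟩
        · simp only [N.colex_s_one_zero_one, hD.inr_promotedEdge, hτ.2]

/-- The model's extra condition `π j = 2` is automatic for the colourings of the construction as
soon as some edge is promoted. -/
theorem IsGivenBy.isColoring_iff (hD : D.IsGivenBy j k P) (hP : ∃ φ, P φ)
    (col : Set D.HVertex → Fin 3) : D.IsColoring col ↔ ∃ π, hD.model.IsColoring col π := by
  obtain ⟨τ, hτ⟩ := exists_perm hD.j_ne_k
  have hneg : ∀ {i φ}, ¬ (i = j ∧ P φ) →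
      hD.model.edge i φ = D.oldEdge (N.colexFlag φ (Equiv.swap 0 i)) := by
    intro i φ h
    rw [D.oldEdge_eq, Equiv.swap_apply_left]
    exact dif_neg h
  have hneg' : ∀ {φ} {π : Equiv.Perm (Fin 3)}, ¬ (π 0 = j ∧ P φ) →
      hD.model.edge (π 0) φ = D.oldEdge (N.colexFlag φ π) := by
    intro φ π h
    rw [D.oldEdge_eq]
    exact dif_neg h
  have hpos : ∀ {φ} {π : Equiv.Perm (Fin 3)} (h : D.IsPromoted (N.colexFlag φ π)),
      hD.model.edge j φ = D.rankThreeEdge _ h := by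
    intro φ π h
    rw [hD.rankThreeEdge_eq φ π]
    exact dif_pos ⟨rfl, ((hD.isPromoted_iff _ _).1 h).1⟩
  constructor
  · rintro ⟨hcol, π, hold, hthree⟩
    have hedge : ∀ (i : Fin 3) (φ : N.Flag), col (hD.model.edge i φ) = π i := by
      intro i φ
      by_cases h : i = j ∧ P φ
      · obtain ⟨rfl, h⟩ := h
        have hx := (hD.isPromoted_iff φ τ).2 ⟨h, hτ⟩
        rw [hpos hx, hthree, N.colex_edgeColor, hτ.1]
      · rw [hneg h, hold, N.colex_edgeColor, Equiv.swap_apply_left]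
        rwa [hD.exists_promoted_iff, Equiv.swap_apply_left]
    -- A promoted edge has rank 3, hence colour `2`, and this colour is also `π j`.
    refine ⟨π, hcol, hedge, ?_⟩
    obtain ⟨φ, hφ⟩ := hP
    refine (hedge j φ).symm.trans (hcol.rank_three _ (hD.model.edge_mem j φ) ?_)
    exact hD.model.ncard_edge_pos hφ
  · rintro ⟨π, hcol, hedge, hj⟩
    refine ⟨hcol, π, fun x hx => ?_, fun x hx => ?_⟩
    · obtain ⟨φ, σ, rfl⟩ := N.exists_colexFlag x
      rw [hD.exists_promoted_iff] at hx
      rw [N.colex_edgeColor, ← hneg' hx]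
      exact hedge _ φ
    · obtain ⟨φ, σ, rfl⟩ := N.exists_colexFlag x
      rw [N.colex_edgeColor, ← hpos hx, ((hD.isPromoted_iff _ _).1 hx).2.1]
      exact hedge _ φ

end Promotion

/-! ### The two families of choices -/

namespace EmbeddedGraph

variable {Γ : EmbeddedGraph}

theorem Loopless.s_ne (hl : Γ.Loopless) (hdeg : ∀ v, 2 < Γ.degree v) (i i' : Fin 3) (φ : Γ.Flag)
    (h : i ≠ i') : Γ.s i φ ≠ Γ.s i' φ := by
  have h01 : Γ.s 0 φ ≠ Γ.s 1 φ := fun h => hl φ (by rw [h, Γ.vertex_s_one])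
  have h02 : Γ.s 0 φ ≠ Γ.s 2 φ := fun h => Γ.ne_diag φ (by rw [← h, Γ.invol])
  have h12 : Γ.s 1 φ ≠ Γ.s 2 φ := Γ.s_one_ne_s_two φ (hdeg _)
  fin_cases i <;> fin_cases i' <;>
    first
    | exact absurd rfl h
    | assumption
    | exact Ne.symm ‹_›

/-- An edge between a `v`-face (colour `0`) and an `e`-face (colour `1`) has colour `2`, and the
alternate edges of the `v`-face have colour `1`. Every flag lies on a `v`-face, so `P` is trivial.
-/
theorem IsVertexPromotion.isGivenBy {D : Promotion Γ.colex} (hD : Γ.IsVertexPromotion D)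
    (hl : Γ.Loopless) (hdeg : ∀ v, 2 < Γ.degree v) : D.IsGivenBy 2 1 (fun _ => True) where
  P_j _ _ := trivial
  P_k _ _ := trivial
  j_ne_k := by decide
  s_ne := hl.s_ne hdeg
  rot_ne φ _ := (Γ.s_one_s_two_ne φ (hdeg _)).symm
  isPromoted_iff φ π := by
    have hF : Γ.colex.face (Γ.colexFlag φ π) ∈ D.F ↔ π 2 = 0 := by
      rw [hD.1]
      exact Iff.rfl
    have key : ∀ π : Equiv.Perm (Fin 3), π 2 = 0 ∧ π 1 = 1 ↔ π 0 = 2 ∧ π 1 = 1 := by decide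
    rw [true_and, ← key, Promotion.IsPromoted, hF, Γ.colex_color_s_two]
    refine and_congr_right fun h => ?_
    rw [hD.2 _ (hF.2 h)]

theorem IsVertexPromotion.not_isBombinCode {D : Promotion Γ.colex} (hD : Γ.IsVertexPromotion D)
    (hl : Γ.Loopless) (hdeg : ∀ v, 2 < Γ.degree v) (hbip : ¬ Γ.dual.IsBipartite)
    {col : Set D.HVertex → Fin 3} (hcol : D.IsColoring col) :
    ¬ IsBombinCode (D.hypergraph.code col) := by
  intro hB
  obtain ⟨φ₀⟩ := Γ.nonempty_flag
  have hG := hD.isGivenBy hl hdeg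
  obtain ⟨π, hπ⟩ := (hG.isColoring_iff ⟨φ₀, trivial⟩ col).1 hcol
  obtain ⟨K, hK, n, t, hn, h2n, ht, hcard⟩ := hπ.card_gauge_code
  obtain ⟨t', hn', hcard'⟩ := hB.exists_card
  have hF : Nat.card {φ // hG.model.P φ} = Nat.card hG.model.N.Flag :=
    Nat.card_congr (Equiv.subtypeUnivEquiv fun _ => trivial)
  -- Here `n = 3 * t`, which makes the two numbers of fibres equal; cancelling the gauge group
  -- leaves `|K| = 4`.
  have hK4 : Nat.card K = 4 := by
    obtain rfl : t = t' := by omega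
    obtain rfl : n = 3 * t := by omega
    rw [show 2 * (3 * t) = 6 * t by ring, ← hcard', mul_right_comm, mul_right_comm _ 4] at hcard
    refine Nat.eq_of_mul_eq_mul_left (Nat.pos_of_ne_zero fun h0 => ?_) hcard
    rw [mul_right_comm, h0, zero_mul] at hcard'
    exact pow_ne_zero _ two_ne_zero hcard'.symm
  have hK2 : ∀ s ∈ K, ∀ φ : Γ.Flag, s (hG.model.old φ) = s (hG.model.old φ₀) := by
    intro s hs
    obtain ⟨hold, hnew, hsum⟩ := hK s hs
    let u : Γ.Flag → ZMod 2 := fun φ => s (hG.model.old φ)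
    let w : Γ.Flag → ZMod 2 := fun φ => s (hG.model.new φ trivial)
    have hu0 : ∀ φ, u (Γ.s 0 φ) = u φ := fun φ => hold 0 φ (by decide : (0 : Fin 3) ≠ 2)
    have hu1 : ∀ φ, u (Γ.s 1 φ) = u φ := fun φ => hold 1 φ (by decide : (1 : Fin 3) ≠ 2)
    have hsum' : ∀ φ, u φ + u (Γ.s 2 φ) + w φ = 0 := fun φ => hsum φ trivial
    have hwu : ∀ φ, w φ = u φ + u (Γ.s 2 φ) := by
      intro φ
      rw [eq_comm, ← CharTwo.add_eq_zero]
      exact hsum' φ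
    have hw0 : ∀ φ, w (Γ.s 0 φ) = w φ := by
      intro φ
      rw [hwu, hwu, ← Γ.comm, hu0, hu0]
    have hw1 : ∀ φ, w (Γ.s 1 φ) = w φ := fun φ => hnew φ trivial
    have hw2 : ∀ φ, w (Γ.s 2 φ) = w φ := by
      intro φ
      rw [hwu, hwu, Γ.invol, add_comm]
    -- `w` is the sum of `u` across an edge, hence invariant under `s 0` and `s 2`; the cycle edges
    -- give invariance under `s 1`.
    have hw : ∀ φ, w φ = w φ₀ := fun φ => Γ.forall_of_closed (S := {φ | w φ = w φ₀}) (by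
      intro i φ h
      fin_cases i
      · exact (hw0 φ).trans h
      · exact (hw1 φ).trans h
      · exact (hw2 φ).trans h) rfl φ
    have hzero : w φ₀ = 0 := by
      by_contra hne
      -- If the common value of `w` is not zero, then `u` takes different values on the two sides of
      -- every edge.
      refine hbip ⟨Quot.lift (fun φ : Γ.Flag => decide (u φ = 0)) ?_, fun φ h => ?_⟩
      · rintro φ _ ⟨i, rfl | rfl, rfl⟩
        · change decide (u φ = 0) = decide (u (Γ.s 1 φ) = 0)
          exact congrArg (fun z => decide (z = 0)) (hu1 φ).symm
        · change decide (u φ = 0) = decide (u (Γ.s 0 φ) = 0)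
          exact congrArg (fun z => decide (z = 0)) (hu0 φ).symm
      · change decide (u φ = 0) = decide (u (Γ.s 2 φ) = 0) at h
        have hφ := hwu φ
        rw [hw φ] at hφ
        rw [hφ] at hne
        revert h hne
        generalize u φ = x
        generalize u (Γ.s 2 φ) = y
        revert x y
        decide
    refine fun φ => Γ.forall_of_closed (S := {φ | u φ = u φ₀}) ?_ rfl φ
    intro i φ h
    fin_cases i
    · exact (hu0 φ).trans h
    · exact (hu1 φ).trans h
    · refine Eq.trans ?_ h
      have := hwu φ
      rw [hw φ, hzero] at this
      exact (CharTwo.add_eq_zero.1 this.symm).symm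
  -- The value at one old vertex determines those at all old vertices, and the rank-3 relations then
  -- determine the new ones.
  have hle : Nat.card K ≤ Nat.card (ZMod 2) := by
    refine Nat.card_le_card_of_injective (fun s => s.1 (hG.model.old φ₀)) fun s s' h => ?_
    refine Subtype.ext (funext fun v => ?_)
    have hφ : ∀ φ : hG.model.N.Flag, s.1 (hG.model.old φ) = s'.1 (hG.model.old φ) := fun φ =>
      (hK2 s.1 s.2 φ).trans (h.trans (hK2 s'.1 s'.2 φ).symm)
    rcases hG.model.cases v with ⟨φ, rfl⟩ | ⟨φ, hφP, rfl⟩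
    · exact hφ φ
    · have h1 := (hK s.1 s.2).2.2 φ hφP
      have h2 := (hK s'.1 s'.2).2.2 φ hφP
      rw [hφ φ, hφ (hG.model.N.s hG.model.j φ)] at h1
      exact add_left_cancel (h1.trans h2.symm)
  rw [hK4, Nat.card_zmod] at hle
  omega

/-! #### The 2-colex of the dual of the medial graph -/

variable (Γ) in
/-- A flag of the dual of the medial graph. -/
def medialFlag (φ : Γ.Flag) (b : Bool) : Γ.medial.dual.Flag := (φ, b)

theorem medialFlag_s_zero (φ : Γ.Flag) (b : Bool) :
    Γ.medial.dual.s 0 (Γ.medialFlag φ b) = Γ.medialFlag φ !b := rfl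

theorem medialFlag_s_one (φ : Γ.Flag) (b : Bool) : Γ.medial.dual.s 1 (Γ.medialFlag φ b) =
    Γ.medialFlag (if b then Γ.s 2 φ else Γ.s 0 φ) b := rfl

theorem medialFlag_s_two (φ : Γ.Flag) (b : Bool) :
    Γ.medial.dual.s 2 (Γ.medialFlag φ b) = Γ.medialFlag (Γ.s 1 φ) b := rfl

theorem medialFlag_inj {φ ψ : Γ.Flag} {b c : Bool} :
    Γ.medialFlag φ b = Γ.medialFlag ψ c ↔ φ = ψ ∧ b = c := Prod.mk_inj

theorem exists_medialFlag (x : Γ.medial.dual.Flag) : ∃ φ b, x = Γ.medialFlag φ b :=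
  ⟨x.1, x.2, rfl⟩

variable (Γ) in
/-- The flag belongs to a face of the medial graph which comes from a vertex. -/
def IsVertexFlag (x : Γ.medial.dual.Flag) : Prop := x.2 = true

theorem isVertexFlag_iff (φ : Γ.Flag) (b : Bool) : Γ.IsVertexFlag (Γ.medialFlag φ b) ↔ b = true :=
  Iff.rfl

theorem Loopless.medial_s_ne (hl : Γ.Loopless) (hdeg : ∀ v, 2 < Γ.degree v) (i i' : Fin 3)
    (x : Γ.medial.dual.Flag) (h : i ≠ i') : Γ.medial.dual.s i x ≠ Γ.medial.dual.s i' x := by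
  obtain ⟨φ, b, rfl⟩ := exists_medialFlag x
  have hne := hl.s_ne hdeg
  have h01 : Γ.medial.dual.s 0 (Γ.medialFlag φ b) ≠ Γ.medial.dual.s 1 (Γ.medialFlag φ b) := by
    rw [medialFlag_s_zero, medialFlag_s_one, Ne, medialFlag_inj]
    simp
  have h02 : Γ.medial.dual.s 0 (Γ.medialFlag φ b) ≠ Γ.medial.dual.s 2 (Γ.medialFlag φ b) := by
    rw [medialFlag_s_zero, medialFlag_s_two, Ne, medialFlag_inj]
    simp
  have h12 : Γ.medial.dual.s 1 (Γ.medialFlag φ b) ≠ Γ.medial.dual.s 2 (Γ.medialFlag φ b) := by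
    rw [medialFlag_s_one, medialFlag_s_two, Ne, medialFlag_inj]
    cases b
    · simpa using hne 0 1 φ (by decide)
    · simpa using hne 2 1 φ (by decide)
  fin_cases i <;> fin_cases i' <;>
    first
    | exact absurd rfl h
    | assumption
    | exact Ne.symm ‹_›

/-- Rank-3 edges border `v`- and `f`-faces, so they have colour `1` and alternate with edges of
colour `2`. The involutions `s 1` and `s 2` keep the Boolean of a medial flag, so the chosen faces
form a union of orbits. -/
theorem IsMedialPromotion.isGivenBy {D : Promotion Γ.medial.dual.colex}
    (hD : Γ.IsMedialPromotion D) (hl : Γ.Loopless) (hdeg : ∀ v, 2 < Γ.degree v) :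
    D.IsGivenBy 1 2 Γ.IsVertexFlag where
  P_j x h := by
    obtain ⟨φ, b, rfl⟩ := exists_medialFlag x
    exact h
  P_k x h := by
    obtain ⟨φ, b, rfl⟩ := exists_medialFlag x
    exact h
  j_ne_k := by decide
  s_ne := hl.medial_s_ne hdeg
  rot_ne x h := by
    obtain ⟨φ, b, rfl⟩ := exists_medialFlag x
    obtain rfl := (isVertexFlag_iff φ b).1 h
    rw [medialFlag_s_two, medialFlag_s_one, medialFlag_s_one, medialFlag_s_two, Ne, medialFlag_inj]
    simpa using (Γ.s_one_s_two_ne φ (hdeg _)).symm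
  isPromoted_iff x π := by
    have hF : Γ.medial.dual.colex.face (Γ.medial.dual.colexFlag x π) ∈ D.F ↔
        Γ.IsVertexFlag x ∧ π 2 = 0 := by
      rw [hD.1]
      constructor
      · rintro ⟨ψ, τ, hτ, h⟩
        refine Γ.medial.dual.colex.mem_of_cell_eq (T := {0, 1})
          (S := {y | Γ.IsVertexFlag y.1 ∧ y.2 2 = 0}) ?_ h.symm ⟨rfl, hτ⟩
        rintro i (rfl | rfl) ⟨y, σ⟩ ⟨hy, hσ⟩
        · refine ⟨?_, hσ⟩
          have h0 : ∀ σ : Equiv.Perm (Fin 3), σ 2 = 0 → σ 0 = 1 ∨ σ 0 = 2 := by decide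
          obtain ⟨φ, b, rfl⟩ := exists_medialFlag y
          change Γ.IsVertexFlag (Γ.medial.dual.s (σ 0) (Γ.medialFlag φ b))
          rcases h0 σ hσ with h | h
          · rw [h]; exact hy
          · rw [h]; exact hy
        · refine ⟨hy, ?_⟩
          change (σ * Equiv.swap 0 1 : Equiv.Perm (Fin 3)) 2 = 0
          rw [Equiv.Perm.mul_apply, show (Equiv.swap 0 1 : Equiv.Perm (Fin 3)) 2 = 2 by decide]
          exact hσ
      · rintro ⟨hx, hπ⟩
        obtain ⟨φ, b, rfl⟩ := exists_medialFlag x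
        obtain rfl := (isVertexFlag_iff φ b).1 hx
        exact ⟨φ, π, hπ, rfl⟩
    have key : ∀ π : Equiv.Perm (Fin 3), π 2 = 0 ∧ π 1 = 2 ↔ π 0 = 1 ∧ π 1 = 2 := by decide
    rw [← key, ← and_assoc, Promotion.IsPromoted, hF, Γ.medial.dual.colex_color_s_two]
    refine and_congr_right fun h => ?_
    have h1 := hD.2 _ (hF.2 h)
    have h0 := D.side_ne _ (hF.2 h)
    rw [← D.color_eq _ (hF.2 h), colex_color, h.2] at h0
    have h2 : ∀ c : Fin 3, c ≠ 1 → c ≠ 0 → c = 2 := by decide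
    rw [h2 _ h1 h0]

/-- Even degree above 2 means at least 4, so at least eight flags at each vertex; without loops
there are two vertices. -/
theorem sixteen_le_card_flag (hl : Γ.Loopless) (hdeg : ∀ v, Even (Γ.degree v) ∧ 2 < Γ.degree v) :
    16 ≤ Nat.card Γ.Flag := by
  have := Γ.finite_flag
  obtain ⟨φ⟩ := Γ.nonempty_flag
  have h8 : ∀ v, 8 ≤ {ψ | Γ.vertex ψ = v}.ncard := by
    intro v
    obtain ⟨⟨m, hm⟩, h2⟩ := hdeg v
    change 8 ≤ Nat.card {ψ // Γ.vertex ψ = v}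
    unfold degree at hm h2
    omega
  have hdisj : Disjoint {ψ | Γ.vertex ψ = Γ.vertex φ} {ψ | Γ.vertex ψ = Γ.vertex (Γ.s 0 φ)} :=
    Set.disjoint_left.2 fun ψ h h' => hl φ (Eq.trans (Eq.symm h) h')
  have hle := Set.ncard_le_ncard (Set.subset_univ
    ({ψ | Γ.vertex ψ = Γ.vertex φ} ∪ {ψ | Γ.vertex ψ = Γ.vertex (Γ.s 0 φ)})) (Set.toFinite _)
  rw [Set.ncard_union_eq hdisj (Set.toFinite _) (Set.toFinite _), Set.ncard_univ] at hle
  have := h8 (Γ.vertex φ)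
  have := h8 (Γ.vertex (Γ.s 0 φ))
  omega

theorem IsMedialPromotion.not_isBombinCode {D : Promotion Γ.medial.dual.colex}
    (hD : Γ.IsMedialPromotion D) (hl : Γ.Loopless)
    (hdeg : ∀ v, Even (Γ.degree v) ∧ 2 < Γ.degree v) {col : Set D.HVertex → Fin 3}
    (hcol : D.IsColoring col) : ¬ IsBombinCode (D.hypergraph.code col) := by
  intro hB
  obtain ⟨φ₀⟩ := Γ.nonempty_flag
  have hG := hD.isGivenBy hl fun v => (hdeg v).2
  obtain ⟨π, hπ⟩ := (hG.isColoring_iff ⟨Γ.medialFlag φ₀ true, rfl⟩ col).1 hcol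
  obtain ⟨K, -, n, t, hn, h2n, ht, hcard⟩ := hπ.card_gauge_code
  obtain ⟨t', hn', hcard'⟩ := hB.exists_card
  have hN : Nat.card hG.model.N.Flag = 2 * Nat.card Γ.Flag := by
    change Nat.card (Γ.Flag × Bool) = _
    rw [Nat.card_prod, Nat.card_eq_fintype_card (α := Bool), Fintype.card_bool, mul_comm]
  have hP : Nat.card {x // hG.model.P x} = Nat.card Γ.Flag := by
    refine Nat.card_congr ⟨fun x => x.1.1, fun φ => ⟨Γ.medialFlag φ true, rfl⟩, ?_, fun φ => rfl⟩
    rintro ⟨⟨φ, b⟩, h⟩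
    obtain rfl : b = true := h
    rfl
  have h16 := sixteen_le_card_flag hl hdeg
  generalize Nat.card Γ.Flag = m at *
  obtain rfl : m = t := by omega
  have hKpos : 1 ≤ Nat.card K := Nat.card_pos
  have hle : Nat.card (D.hypergraph.code col).gauge * 2 ^ m ≤ 2 ^ (2 * n) := by
    rw [← hcard]
    exact Nat.mul_le_mul_right _ (Nat.le_mul_of_pos_right _ hKpos)
  -- Since `2 * n = 5 * m = 6 * t'`, comparing exponents gives `m ≤ t' + 2`, that is, `m ≤ 12`.
  have hpow : 2 ^ (6 * t' + m) ≤ 2 ^ (2 * n + 2 + t') := by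
    calc 2 ^ (6 * t' + m) = (Nat.card (D.hypergraph.code col).gauge * 2 ^ m) * (4 * 2 ^ t') := by
          rw [pow_add, ← hcard']; ring
      _ ≤ 2 ^ (2 * n) * (4 * 2 ^ t') := Nat.mul_le_mul_right _ hle
      _ = 2 ^ (2 * n + 2 + t') := by ring
  have := (Nat.pow_le_pow_iff_right (by norm_num)).1 hpow
  omega

end EmbeddedGraph

/-! ### An example -/

namespace EmbeddedGraph

theorem colex_face_eq_iff (N : EmbeddedGraph) (φ ψ : N.Flag) (π τ : Equiv.Perm (Fin 3))
    (hπ : π 2 = 0) : N.colex.face (N.colexFlag ψ τ) = N.colex.face (N.colexFlag φ π) ↔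
      N.vertex ψ = N.vertex φ ∧ τ 2 = 0 := by
  have hswap : ∀ σ : Equiv.Perm (Fin 3), (σ * Equiv.swap 0 1 : Equiv.Perm (Fin 3)) 2 = σ 2 := by
    decide
  constructor
  · intro h
    refine N.colex.mem_of_cell_eq (T := {0, 1}) (S := {y | N.vertex y.1 = N.vertex φ ∧ y.2 2 = 0})
      ?_ h.symm ⟨rfl, hπ⟩
    rintro i (rfl | rfl) ⟨y, σ⟩ ⟨hy, hσ⟩
    · refine ⟨Eq.trans ?_ hy, hσ⟩
      have h0 : ∀ σ : Equiv.Perm (Fin 3), σ 2 = 0 → σ 0 = 1 ∨ σ 0 = 2 := by decide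
      change N.vertex (N.s (σ 0) y) = N.vertex y
      rcases h0 σ hσ with h | h
      · rw [h, N.vertex_s_one]
      · rw [h, N.vertex_s_two]
    · exact ⟨hy, (hswap σ).trans hσ⟩
  · rintro ⟨hv, hτ⟩
    have hperm : ∀ χ σ σ', σ 2 = σ' 2 →
        N.colex.face (N.colexFlag χ σ) = N.colex.face (N.colexFlag χ σ') := by
      intro χ σ σ' h
      have key : ∀ σ σ' : Equiv.Perm (Fin 3), σ 2 = σ' 2 → σ = σ' ∨ σ = σ' * Equiv.swap 0 1 := by
        decide
      rcases key σ σ' h with rfl | rfl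
      · rfl
      · exact N.colex.face_s_one (N.colexFlag χ σ')
    refine N.mem_of_cell_eq (T := {1, 2}) (S := {χ | ∀ τ : Equiv.Perm (Fin 3), τ 2 = 0 →
      N.colex.face (N.colexFlag χ τ) = N.colex.face (N.colexFlag φ π)}) ?_ hv.symm
      (fun τ hτ => hperm φ τ π (hτ.trans hπ.symm)) τ hτ
    intro i hi χ hχ τ hτ
    have hex : ∀ i : Fin 3, i = 1 ∨ i = 2 → ∃ σ : Equiv.Perm (Fin 3), σ 0 = i ∧ σ 2 = 0 := by
      decide
    obtain ⟨σ, rfl, hσ⟩ := hex i hi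
    rw [hperm _ τ σ (hτ.trans hσ.symm), ← colex_s_zero]
    exact (N.colex.face_s_zero _).trans (hχ σ hσ)

/-- Each flag at the vertex lifts to two flags of the `v`-face, one for each order of the two
remaining colours, and this cancels the halving in `faceSize`. -/
theorem colex_faceSize (N : EmbeddedGraph) (φ : N.Flag) (π : Equiv.Perm (Fin 3)) (hπ : π 2 = 0) :
    N.colex.faceSize (N.colex.face (N.colexFlag φ π)) =
      Nat.card {ψ // N.vertex ψ = N.vertex φ} := by
  have e : {x : N.colex.Flag // N.colex.face x = N.colex.face (N.colexFlag φ π)} ≃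
      {ψ // N.vertex ψ = N.vertex φ} × {τ : Equiv.Perm (Fin 3) // τ 2 = 0} :=
    { toFun := fun x => (⟨x.1.1, ((N.colex_face_eq_iff φ x.1.1 π x.1.2 hπ).1 x.2).1⟩,
        ⟨x.1.2, ((N.colex_face_eq_iff φ x.1.1 π x.1.2 hπ).1 x.2).2⟩)
      invFun := fun y => ⟨N.colexFlag y.1.1 y.2.1,
        (N.colex_face_eq_iff φ y.1.1 π y.2.1 hπ).2 ⟨y.1.2, y.2.2⟩⟩
      left_inv := fun _ => rfl
      right_inv := fun _ => rfl }
  have h2 : Nat.card {τ : Equiv.Perm (Fin 3) // τ 2 = 0} = 2 := by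
    rw [Nat.card_eq_fintype_card]
    decide
  unfold faceSize
  rw [Nat.card_congr e, Nat.card_prod, h2, Nat.mul_div_cancel _ two_pos]

/-- Two vertices joined by four edges in the projective plane, with three faces.  The flags at a
vertex are numbered in their cyclic order. -/
def fourEdges : EmbeddedGraph where
  Flag := Bool × Fin 8
  finite_flag := inferInstance
  nonempty_flag := inferInstance
  s := ![fun p => (!p.1, ![0, 2, 1, 3, 4, 5, 6, 7] p.2),
    fun p => (p.1, ![1, 0, 3, 2, 5, 4, 7, 6] p.2),
    fun p => (p.1, ![7, 2, 1, 4, 3, 6, 5, 0] p.2)]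
  invol := by decide
  ne_self := by decide
  comm := by decide
  ne_diag := by decide
  connected := by
    refine ⟨fun a b => ?_⟩
    obtain ⟨p, rfl⟩ := Quot.mk_surjective a
    obtain ⟨q, rfl⟩ := Quot.mk_surjective b
    set s : Fin 3 → Bool × Fin 8 → Bool × Fin 8 :=
      ![fun p => (!p.1, ![0, 2, 1, 3, 4, 5, 6, 7] p.2),
        fun p => (p.1, ![1, 0, 3, 2, 5, 4, 7, 6] p.2),
        fun p => (p.1, ![7, 2, 1, 4, 3, 6, 5, 0] p.2)]
    have step : ∀ (p : Bool × Fin 8) (i : Fin 3),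
        Quot.mk (fun φ ψ => ∃ i : Fin 3, ψ = s i φ) (s i p) = Quot.mk _ p :=
      fun p i => (Quot.sound ⟨i, rfl⟩).symm
    have hall : ∀ p : Bool × Fin 8,
        Quot.mk (fun φ ψ => ∃ i : Fin 3, ψ = s i φ) p = Quot.mk _ (false, 0) := by
      have hrot : ∀ v, ∀ i : Fin 8,
          Quot.mk (fun φ ψ => ∃ i : Fin 3, ψ = s i φ) (v, i) = Quot.mk _ (v, 0) := by
        intro v
        have h1 := step (v, 0) 1
        have h2 := (step (v, 1) 2).trans h1
        have h3 := (step (v, 2) 1).trans h2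
        have h4 := (step (v, 3) 2).trans h3
        have h5 := (step (v, 4) 1).trans h4
        have h6 := (step (v, 5) 2).trans h5
        have h7 := (step (v, 6) 1).trans h6
        intro i
        fin_cases i
        · rfl
        · exact h1
        · exact h2
        · exact h3
        · exact h4
        · exact h5
        · exact h6
        · exact h7
      rintro ⟨v, i⟩
      rw [hrot]
      cases v
      · rfl
      · exact step (false, 0) 0
    exact (hall p).trans (hall q).symm

/-- A flag of `fourEdges`. -/
def fourEdgesFlag (v : Bool) (i : Fin 8) : fourEdges.Flag := (v, i)

theorem fourEdges_vertex_eq_iff (φ ψ : fourEdges.Flag) :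
    fourEdges.vertex φ = fourEdges.vertex ψ ↔ φ.1 = ψ.1 := by
  constructor
  · intro h
    refine fourEdges.mem_of_cell_eq (T := {1, 2}) (S := {χ | χ.1 = ψ.1}) ?_ h.symm rfl
    rintro i (rfl | rfl) χ hχ <;> exact hχ
  · obtain ⟨v, i⟩ := φ
    obtain ⟨w, k⟩ := ψ
    rintro (rfl : v = w)
    have hrot : ∀ i : Fin 8,
        fourEdges.vertex (fourEdgesFlag v i) = fourEdges.vertex (fourEdgesFlag v 0) := by
      have h1 := fourEdges.vertex_s_one (fourEdgesFlag v 0)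
      have h2 := (fourEdges.vertex_s_two (fourEdgesFlag v 1)).trans h1
      have h3 := (fourEdges.vertex_s_one (fourEdgesFlag v 2)).trans h2
      have h4 := (fourEdges.vertex_s_two (fourEdgesFlag v 3)).trans h3
      have h5 := (fourEdges.vertex_s_one (fourEdgesFlag v 4)).trans h4
      have h6 := (fourEdges.vertex_s_two (fourEdgesFlag v 5)).trans h5
      have h7 := (fourEdges.vertex_s_one (fourEdgesFlag v 6)).trans h6
      intro i
      fin_cases i
      · rfl
      · exact h1
      · exact h2
      · exact h3
      · exact h4
      · exact h5
      · exact h6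
      · exact h7
    exact (hrot i).trans (hrot k).symm

theorem fourEdges_card_vertex (v : fourEdges.Vertex) :
    Nat.card {φ // fourEdges.vertex φ = v} = 8 := by
  obtain ⟨ψ, rfl⟩ := Quot.mk_surjective v
  have e : {φ // fourEdges.vertex φ = fourEdges.vertex ψ} ≃ Fin 8 :=
    { toFun := fun φ => φ.1.2
      invFun := fun i => ⟨fourEdgesFlag ψ.1 i, (fourEdges_vertex_eq_iff _ _).2 rfl⟩
      left_inv := fun φ => Subtype.ext
        (Prod.ext ((fourEdges_vertex_eq_iff _ _).1 φ.2).symm rfl)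
      right_inv := fun _ => rfl }
  exact (Nat.card_congr e).trans (Nat.card_fin 8)

theorem fourEdges_degree (v : fourEdges.Vertex) : fourEdges.degree v = 4 := by
  unfold degree
  rw [fourEdges_card_vertex]

theorem fourEdges_loopless : fourEdges.Loopless := by
  intro φ h
  have := (fourEdges_vertex_eq_iff _ _).1 h
  exact Bool.not_ne_self φ.1 this.symm

/-- The twisted edge, at which `s 0` exchanges the positions `1` and `2`, has the same face on both
sides: it is a loop of the dual. -/
theorem fourEdges_not_isBipartite_dual : ¬ fourEdges.dual.IsBipartite := by
  rintro ⟨κ, hκ⟩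
  refine hκ (fourEdgesFlag false 1) (congrArg κ ?_)
  have h1 : ∀ φ : fourEdges.Flag,
      fourEdges.dual.vertex (fourEdges.s 1 φ) = fourEdges.dual.vertex φ :=
    fun φ => fourEdges.dual.vertex_s_one φ
  have h0 : ∀ φ : fourEdges.Flag,
      fourEdges.dual.vertex (fourEdges.s 0 φ) = fourEdges.dual.vertex φ :=
    fun φ => fourEdges.dual.vertex_s_two φ
  exact (((h1 (fourEdgesFlag false 3)).trans (h0 (fourEdgesFlag true 3))).trans
    ((h1 (fourEdgesFlag true 2)).trans (h0 (fourEdgesFlag false 1)))).symm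

/-- All the faces from the two vertices, with the edges of rank 3 on the faces from the edges. -/
def fourEdgesPromotion : Promotion fourEdges.colex where
  r := 0
  F := {f | fourEdges.colex.color f = 0}
  nonempty := ⟨fourEdges.colex.face (fourEdges.colexFlag (fourEdgesFlag false 0)
    (Equiv.swap 0 2)), by
      change (Equiv.swap 0 2 : Equiv.Perm (Fin 3)) 2 = 0
      decide⟩
  color_eq _ h := h
  size f h := by
    obtain ⟨x, rfl⟩ := Quot.mk_surjective f
    obtain ⟨φ, π, rfl⟩ := fourEdges.exists_colexFlag x
    have hsize : fourEdges.colex.faceSize (fourEdges.colex.face (fourEdges.colexFlag φ π)) = 8 :=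
      (fourEdges.colex_faceSize φ π h).trans (fourEdges_card_vertex _)
    change 4 ∣ fourEdges.colex.faceSize (fourEdges.colex.face (fourEdges.colexFlag φ π)) ∧
      4 < fourEdges.colex.faceSize (fourEdges.colex.face (fourEdges.colexFlag φ π))
    rw [hsize]
    decide
  side _ := 1
  side_ne _ _ := by decide

theorem fourEdgesPromotion_isVertexPromotion : fourEdges.IsVertexPromotion fourEdgesPromotion :=
  ⟨rfl, fun _ _ => rfl⟩

theorem exists_not_isBombinCode : ∃ (M : TwoColex) (D : Promotion M)
    (col : Set D.HVertex → Fin 3), D.hypergraph.IsAdmissible ∧ D.IsColoring col ∧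
      ¬ IsBombinCode (D.hypergraph.code col) := by
  have hdeg : ∀ v, 2 < fourEdges.degree v := fun v => by rw [fourEdges_degree]; decide
  have hG := fourEdgesPromotion_isVertexPromotion.isGivenBy fourEdges_loopless hdeg
  -- The four corners at each vertex are coloured alternately, which colours the two new 4-cycles
  -- properly.
  let χ : fourEdges.Flag → Bool :=
    fun φ => ![false, false, true, true, false, false, true, true] φ.2
  have hk : ∀ φ : Bool × Fin 8, χ (fourEdges.s 1 φ) = χ φ := by decide
  have hj : ∀ φ : Bool × Fin 8, χ (fourEdges.s 2 φ) = !χ φ := by decide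
  obtain ⟨col, hcol⟩ := hG.model.exists_coloring (π := 1) rfl (χ := χ) hk hj
  have hcol' := (hG.isColoring_iff ⟨fourEdgesFlag false 0, trivial⟩ col).2 ⟨_, hcol⟩
  exact ⟨_, _, col, hG.model.isAdmissible, hcol',
    fourEdgesPromotion_isVertexPromotion.not_isBombinCode fourEdges_loopless hdeg
      fourEdges_not_isBipartite_dual hcol'⟩

end EmbeddedGraph

theorem mainTheorem5 :
    (∃ (M : TwoColex) (D : Promotion M) (col : Set D.HVertex → Fin 3),
      D.hypergraph.IsAdmissible ∧ D.IsColoring col ∧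
        ¬ IsBombinCode (D.hypergraph.code col)) ∧
    (∀ Γ : EmbeddedGraph, Γ.Loopless → (∀ v, Even (Γ.degree v) ∧ 2 < Γ.degree v) →
      ∀ (D : Promotion Γ.medial.dual.colex) (col : Set D.HVertex → Fin 3),
        Γ.IsMedialPromotion D → D.IsColoring col →
          ¬ IsBombinCode (D.hypergraph.code col)) ∧
    (∀ Γ : EmbeddedGraph, Γ.Loopless → (∀ v, Even (Γ.degree v) ∧ 2 < Γ.degree v) →
      ¬ Γ.dual.IsBipartite →
      ∀ (D : Promotion Γ.colex) (col : Set D.HVertex → Fin 3),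
        Γ.IsVertexPromotion D → D.IsColoring col →
          ¬ IsBombinCode (D.hypergraph.code col)) :=
  ⟨EmbeddedGraph.exists_not_isBombinCode,
    fun _ hl hdeg _ _ hD hcol => hD.not_isBombinCode hl hdeg hcol,
    fun _ hl hdeg hbip _ _ hD hcol => hD.not_isBombinCode hl (fun v => (hdeg v).2) hbip hcol⟩
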